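/- Let $\mathcal X,\mathcal Y$ be non-empty sets, where $\mathcal Y$ carries a $\sigma$-algebra in which singletons are measurable and may be infinite or uncountable, and let $\mathcal C\subseteq\mathcal Y^{\mathcal X}$ be a non-empty concept class. The *level-constrained Littlestone dimension* $\mathrm D(\mathcal C)$ is the largest $d\in\{0,1,2,\dots\}$ for which there exist instances $x_1,\dots,x_d\in\mathcal X$ and functions $Y_t:\{0,1\}^t\to\mathcal Y$, $t=1,\dots,d$, such that for every $\sigma\in\{0,1\}^d$: (i) $Y_t(\sigma_{<t},0)\ne Y_t(\sigma_{<t},1)$ for all $t\le d$, and (ii) there is $c_\sigma\in\mathcal C$ with $c_\sigma(x_t)=Y_t(\sigma_{\le t})$ for all $t\le d$. If such $d$ are arbitrarily large, $\mathrm D(\mathcal C)=\infty$. A (randomized) *transductive online learner* $\mathcal A$ with horizon $T$ is given the whole sequence $x_1,\dots,x_T\in\mathcal X$ in advance; in round $t$ it draws a prediction $\hat y_t\in\mathcal Y$ from a probability measure that may depend on $x_1,\dots,x_T$ and on the previously revealed labels $y_1,\dots,y_{t-1}$, and then $y_t$ is revealed. Its worst-case expected regret and the optimal expected regret are $$\mathrm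 R_{\mathcal A}(T,\mathcal C)=\sup_{(x_1,y_1),\dots,(x_T,y_T)\in\mathcal X\times\mathcal Y}\Bigl(\mathbb E\Bigl[\sum_{t=1}^T\mathbf 1\{\hat y_t\ne y_t\}\Bigr]-\inf_{c\in\mathcal C}\sum_{t=1}^T\mathbf 1\{c(x_t)\ne y_t\}\Bigr),\qquad \mathrm R^\star(T,\mathcal C)=\inf_{\mathcal A}\mathrm R_{\mathcal A}(T,\mathcal C).$$ **Theorem (regret bound).** For every such $\mathcal C$ and every integer $T\ge 0$ with $T\ge\mathrm D(\mathcal C)$ (so $\mathrm D(\mathcal C)$ is finite), $$\sqrt{\frac{T\,\mathrm D(\mathcal C)}{8}}\;\le\;\mathrm R^\star(T,\mathcal C)\;\le\;\sqrt{T\,\mathrm D(\mathcal C)}\;\log\Bigl(\frac{eT}{\mathrm D(\mathcal C)}\Bigr),$$ where $\log$ is the natural logarithm and the right-hand side is read as $0$ if $\mathrm D(\mathcal C)=0$. -/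

import Mathlib

open MeasureTheory

noncomputable section

namespace TransductiveOnline

/-- `C` shatters a level-constrained Littlestone tree of depth `d`: there are instances
`x₁, …, x_d`, one for each level, and functions `Y_t : {0,1}^t → 𝒴` labelling the edges such that,
for every path `σ ∈ {0,1}^d`, sibling edges along `σ` have distinct labels, and some concept in `C`
agrees with all the labels along `σ`. Levels are indexed from `0`, so that `Fin.take t _ σ` is the
part of `σ` strictly before level `t`, and `Fin.take (t + 1) _ σ` includes level `t`. -/
def ShattersDepth {X Y : Type*} (C : Set (X → Y)) (d : ℕ) : Prop :=
  ∃ (x : Fin d → X) (L : (t : Fin d) → (Fin (t + 1) → Bool) → Y),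
    ∀ σ : Fin d → Bool,
      (∀ t : Fin d,
        L t (Fin.snoc (α := fun _ => Bool) (Fin.take t t.isLt.le σ) false) ≠
          L t (Fin.snoc (α := fun _ => Bool) (Fin.take t t.isLt.le σ) true)) ∧
      ∃ c ∈ C, ∀ t : Fin d, c (x t) = L t (Fin.take (t + 1) t.isLt σ)

/-- The level-constrained Littlestone dimension `D(C)`: the largest depth of a level-constrained
Littlestone tree shattered by `C`, and `⊤` if there are such trees of arbitrarily large depth. -/
def levelDim {X Y : Type*} (C : Set (X → Y)) : ℕ∞ :=
  ⨆ d ∈ {d : ℕ | ShattersDepth C d}, (d : ℕ∞)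

/-- A (randomized) transductive online learner for horizon `T`: it knows the whole sequence of
instances, and in round `t` it turns the labels revealed before round `t` into the distribution on
`Y` from which its prediction is drawn. -/
abbrev Learner (X Y : Type*) [MeasurableSpace Y] (T : ℕ) : Type _ :=
  (Fin T → X) → (t : Fin T) → (Fin t → Y) → ProbabilityMeasure Y

/-- The expected number of mistakes on the labelled sequence `(x_t, y_t)`: the sum over the rounds
`t` of the expectation of the indicator of `ŷ_t ≠ y_t`, where `ŷ_t` is the prediction. -/
def expectedMistakes {X Y : Type*} [MeasurableSpace Y] {T : ℕ} (A : Learner X Y T)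
    (x : Fin T → X) (y : Fin T → Y) : ℝ :=
  ∑ t : Fin T, ∫ p : Y, Set.indicator {p : Y | p ≠ y t} (fun _ => (1 : ℝ)) p
    ∂(A x t (Fin.take t t.isLt.le y) : Measure Y)

/-- The number of rounds in which the concept `c` errs on the labelled sequence `(x_t, y_t)`. -/
def conceptMistakes {X Y : Type*} {T : ℕ} (c : X → Y) (x : Fin T → X) (y : Fin T → Y) : ℕ :=
  Set.ncard {t : Fin T | c (x t) ≠ y t}

/-- The least number of mistakes on `(x_t, y_t)` of a concept in `C` (for nonempty `C`). -/
def bestMistakes {X Y : Type*} {T : ℕ} (C : Set (X → Y)) (x : Fin T → X) (y : Fin T → Y) : ℕ :=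
  ⨅ c : C, conceptMistakes (c : X → Y) x y

/-- The worst-case expected regret `R_A(T, C)` of the learner `A`. -/
def regret {X Y : Type*} [MeasurableSpace Y] {T : ℕ} (A : Learner X Y T)
    (C : Set (X → Y)) : EReal :=
  ⨆ (x : Fin T → X) (y : Fin T → Y),
    ((expectedMistakes A x y - (bestMistakes C x y : ℝ) : ℝ) : EReal)

/-- The optimal expected regret `R⋆(T, C)`. -/
def optimalRegret {X Y : Type*} [MeasurableSpace Y] (T : ℕ) (C : Set (X → Y)) : EReal :=
  ⨅ A : Learner X Y T, regret A C

end TransductiveOnline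

end

/-! Lower bound. Take a shattered sequence of length `D` and repeat its instances in `D` blocks of
almost equal length. In a block the adversary uses only the two labels at the current tree node.
Uniformly random labels would cost any learner at least half the block in expectation, while the
more frequent label errs less than that by half the distance from the origin of a simple random
walk. The adversary is derandomized by choosing each label so that the conditional expectation does
not drop (`exists_labels_walkDist`). The majority label decides the branch to descend, so one
concept is best in all blocks at once (`exists_labels_blocks`). Half the expected distance after `n`
steps is at least about `√(n/8)`, and summing over the blocks gives `√(TD/8)`
(`exists_block_lengths`).

Upper bound. The potential of a version space is the number of subsequences of the remaining
instances that it shatters. Restricting to two different labels of the next instance gives two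
potentials whose sum is at most the old one, so predicting the label of largest potential halves the
potential whenever an error is used for an update. There is one expert for each set `I` of rounds,
updating only in `I`. For a concept `c`, let `I` be the rounds where `c` is right and the expert
wrong: this expert makes at most `|I|` more mistakes than `c`, and `2 ^ |I|` is at most the initial
potential (`exists_expert`). A Sauer–Shelah–Perles count bounds that potential by `(eT/D)^D`, hence
`|I| ≤ M` with `M = D log(eT/D) / log 2`. Exponential weights with prior `p ^ |I|` then have regret
at most `M + R` for suitable `p` and `R` (`optimalRegret_le_of_shatterCount`).

To reach the constant 1 in front of the bound, put `s = √(T/D)` and treat three ranges of `s`: the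
trivial bound `T` for small `s`, the uniform prior `p = 1` for medium `s`, and `p = M/T` for large
`s`. -/

noncomputable section

namespace TransductiveOnline

variable {X Y : Type*}

/-! ### Shattered sequences of instances -/

/-- The concepts of `V` with value `y` at `x`. -/
def restrict (V : Set (X → Y)) (x : X) (y : Y) : Set (X → Y) := {c ∈ V | c x = y}

/-- `V` shatters a level-constrained tree whose levels carry the instances in the list. -/
def Shatters : List X → Set (X → Y) → Prop
  | [], V => V.Nonempty
  | x :: l, V => ∃ y y', y ≠ y' ∧ Shatters l (restrict V x y) ∧ Shatters l (restrict V x y')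

/-- `V` shatters a level-constrained tree with instances `x`, with trees as in
`ShattersDepth`. -/
def ShattersInstances (C : Set (X → Y)) {d : ℕ} (x : Fin d → X) : Prop :=
  ∃ L : (t : Fin d) → (Fin (t + 1) → Bool) → Y,
    ∀ σ : Fin d → Bool,
      (∀ t : Fin d,
        L t (Fin.snoc (α := fun _ => Bool) (Fin.take t t.isLt.le σ) false) ≠
          L t (Fin.snoc (α := fun _ => Bool) (Fin.take t t.isLt.le σ) true)) ∧
      ∃ c ∈ C, ∀ t : Fin d, c (x t) = L t (Fin.take (t + 1) t.isLt σ)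

theorem restrict_mono {V W : Set (X → Y)} (h : V ⊆ W) (x : X) (y : Y) :
    restrict V x y ⊆ restrict W x y := fun _ hc => ⟨h hc.1, hc.2⟩

theorem restrict_subset (V : Set (X → Y)) (x : X) (y : Y) : restrict V x y ⊆ V := fun _ hc => hc.1

theorem Shatters.mono {l : List X} {V W : Set (X → Y)} (h : Shatters l V) (hVW : V ⊆ W) :
    Shatters l W := by
  induction l generalizing V W with
  | nil => exact Set.Nonempty.mono hVW h
  | cons x l ih =>
    obtain ⟨y, y', hne, h1, h2⟩ := h
    exact ⟨y, y', hne, ih h1 (restrict_mono hVW x y), ih h2 (restrict_mono hVW x y')⟩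

theorem snoc_cons_bool {n : ℕ} (a b : Bool) (v : Fin n → Bool) :
    (Fin.snoc (α := fun _ => Bool) (Fin.cons (α := fun _ => Bool) a v) b : Fin (n + 2) → Bool) =
      Fin.cons (α := fun _ => Bool) a (Fin.snoc (α := fun _ => Bool) v b) :=
  (Fin.cons_snoc_eq_snoc_cons a v b).symm

theorem take_succ_cons_bool {n m : ℕ} (h : m ≤ n) (a : Bool) (v : Fin n → Bool) :
    Fin.take (m + 1) (Nat.succ_le_succ h) (Fin.cons (α := fun _ => Bool) a v) =
      (Fin.cons (α := fun _ => Bool) a (Fin.take m h v) : Fin (m + 1) → Bool) := by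
  ext i
  refine Fin.cases ?_ (fun j => ?_) i
  · rfl
  · rfl

theorem snoc_take_succ_cons {d : ℕ} (t : Fin d) (a b : Bool) (v : Fin d → Bool) :
    (Fin.snoc (α := fun _ => Bool)
      (Fin.take t.succ t.succ.isLt.le (Fin.cons (α := fun _ => Bool) a v)) b :
        Fin (t.succ + 1) → Bool) =
      Fin.cons (α := fun _ => Bool) a
        (Fin.snoc (α := fun _ => Bool) (Fin.take t t.isLt.le v) b) := by
  rw [← snoc_cons_bool, ← take_succ_cons_bool]
  rfl

/-- Splitting a tree at its root: the two subtrees share the instances of their levels but have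
independent labels. This is the recursion that defines `Shatters`. -/
theorem shattersInstances_cons {d : ℕ} (C : Set (X → Y)) (x₀ : X) (x : Fin d → X) :
    ShattersInstances C (Fin.cons x₀ x : Fin (d + 1) → X) ↔
      ∃ y y', y ≠ y' ∧ ShattersInstances (restrict C x₀ y) x ∧
        ShattersInstances (restrict C x₀ y') x := by
  constructor
  · rintro ⟨L, hL⟩
    have key : ∀ b : Bool, ShattersInstances (restrict C x₀ (L 0 (fun _ => b))) x := by
      intro b
      refine ⟨fun t τ => L t.succ (Fin.cons (α := fun _ => Bool) b τ), fun σ => ?_⟩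
      obtain ⟨h1, c, hc, h2⟩ := hL (Fin.cons (α := fun _ => Bool) b σ)
      refine ⟨fun t => ?_, c, ⟨hc, ?_⟩, fun t => ?_⟩
      · have := h1 t.succ
        rwa [snoc_take_succ_cons, snoc_take_succ_cons] at this
      · have := h2 0
        rw [Fin.cons_zero] at this
        rw [this]
        congr 1
        ext i
        rw [Fin.eq_zero i]
        rfl
      · have := h2 t.succ
        rw [Fin.cons_succ] at this
        exact this.trans (congrArg (L t.succ) (take_succ_cons_bool t.isLt b σ))
    refine ⟨L 0 (fun _ => false), L 0 (fun _ => true), ?_, key false, key true⟩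
    have := (hL (fun _ => false)).1 0
    convert this using 2
    · ext i
      rw [Fin.eq_zero i]
      rfl
    · ext i
      rw [Fin.eq_zero i]
      rfl
  · rintro ⟨y, y', hne, ⟨L, hL⟩, ⟨L', hL'⟩⟩
    refine ⟨fun t => Fin.cases (motive := fun t => (Fin (t + 1) → Bool) → Y)
      (fun τ => bif τ 0 then y' else y)
      (fun s τ => bif τ 0 then L' s (Fin.tail τ) else L s (Fin.tail τ)) t, fun σ => ?_⟩
    obtain ⟨b, σ, rfl⟩ : ∃ b σ', σ = Fin.cons (α := fun _ => Bool) b σ' :=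
      ⟨σ 0, Fin.tail σ, (Fin.cons_self_tail σ).symm⟩
    refine ⟨fun t => ?_, ?_⟩
    · refine Fin.cases ?_ (fun s => ?_) t
      · exact hne
      · rw [snoc_take_succ_cons, snoc_take_succ_cons]
        cases b
        · exact (hL σ).1 s
        · exact (hL' σ).1 s
    · cases b
      · obtain ⟨-, c, hc, h⟩ := hL σ
        refine ⟨c, hc.1, fun t => ?_⟩
        refine Fin.cases ?_ (fun s => ?_) t
        · exact hc.2
        · exact h s
      · obtain ⟨-, c, hc, h⟩ := hL' σ
        refine ⟨c, hc.1, fun t => ?_⟩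
        refine Fin.cases ?_ (fun s => ?_) t
        · exact hc.2
        · exact h s

theorem shattersInstances_iff {d : ℕ} (C : Set (X → Y)) (x : Fin d → X) :
    ShattersInstances C x ↔ Shatters (List.ofFn x) C := by
  induction d generalizing C with
  | zero =>
    constructor
    · rintro ⟨L, hL⟩
      obtain ⟨-, c, hc, -⟩ := hL Fin.elim0
      exact ⟨c, hc⟩
    · rintro ⟨c, hc⟩
      exact ⟨fun t => t.elim0, fun σ => ⟨fun t => t.elim0, c, hc, fun t => t.elim0⟩⟩
  | succ d ih =>
    obtain ⟨x₀, x, rfl⟩ : ∃ a v, x = (Fin.cons a v : Fin (d + 1) → X) :=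
      ⟨x 0, Fin.tail x, (Fin.cons_self_tail x).symm⟩
    rw [shattersInstances_cons, List.ofFn_cons]
    simp only [ih]
    rfl

theorem shattersDepth_iff (C : Set (X → Y)) (d : ℕ) :
    ShattersDepth C d ↔ ∃ l : List X, l.length = d ∧ Shatters l C := by
  constructor
  · rintro ⟨x, h⟩
    exact ⟨List.ofFn x, by simp, (shattersInstances_iff C x).1 h⟩
  · rintro ⟨l, rfl, h⟩
    refine ⟨l.get, (shattersInstances_iff C l.get).2 ?_⟩
    rwa [List.ofFn_get]

/-- A finite level-constrained Littlestone dimension is attained and bounds the length of every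
shattered sequence. -/
theorem exists_levelDim_eq (C : Set (X → Y)) (hC : C.Nonempty) {T : ℕ}
    (hT : levelDim C ≤ (T : ℕ∞)) :
    ∃ D : ℕ, levelDim C = D ∧ D ≤ T ∧ (∃ l : List X, l.length = D ∧ Shatters l C) ∧
      ∀ l : List X, Shatters l C → l.length ≤ D := by
  have hle : ∀ d, ShattersDepth C d → (d : ℕ∞) ≤ levelDim C := fun d hd =>
    le_iSup₂ (f := fun (d : ℕ) (_ : d ∈ {d : ℕ | ShattersDepth C d}) => (d : ℕ∞)) d hd
  have h0 : ShattersDepth C 0 := (shattersDepth_iff C 0).2 ⟨[], rfl, hC⟩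
  have hbdd : ∀ d, ShattersDepth C d → d ≤ T := fun d hd => by
    exact_mod_cast (hle d hd).trans hT
  -- The set of depths contains 0 since `C` is nonempty, and is bounded by `T`, so its supremum in
  -- `ℕ` is a maximum.
  have hmem : ShattersDepth C (sSup {d | ShattersDepth C d}) :=
    Nat.sSup_mem (s := {d | ShattersDepth C d}) ⟨0, h0⟩ ⟨T, fun d hd => hbdd d hd⟩
  have hmax : ∀ d, ShattersDepth C d → d ≤ sSup {d | ShattersDepth C d} := fun d hd =>
    le_csSup (s := {d | ShattersDepth C d}) ⟨T, fun d hd => hbdd d hd⟩ hd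
  refine ⟨sSup {d | ShattersDepth C d}, le_antisymm ?_ (hle _ hmem), hbdd _ hmem,
    (shattersDepth_iff C _).1 hmem, fun l hl => hmax _ ((shattersDepth_iff C _).2 ⟨l, rfl, hl⟩)⟩
  exact iSup₂_le fun d hd => by exact_mod_cast hmax d hd

/-! ### Counting shattered subsequences -/

open Classical in
/-- The number of subsequences of `l` shattered by `V`. -/
def shatterCount (l : List X) (V : Set (X → Y)) : ℕ :=
  (l.sublists').countP (fun s => Shatters s V)

open Classical in
theorem shatterCount_cons (x : X) (l : List X) (V : Set (X → Y)) :
    shatterCount (x :: l) V =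
      shatterCount l V + (l.sublists').countP (fun s => Shatters (x :: s) V) := by
  simp [shatterCount, List.countP_map, Function.comp_def]

theorem shatterCount_le_cons (x : X) (l : List X) (V : Set (X → Y)) :
    shatterCount l V ≤ shatterCount (x :: l) V := by
  rw [shatterCount_cons]
  exact Nat.le_add_right _ _

/-- A subsequence shattered by both restrictions extends by `x`, so it is counted twice. -/
theorem shatterCount_restrict_add_le {x : X} {l : List X} {V : Set (X → Y)} {y y' : Y}
    (h : y ≠ y') :
    shatterCount l (restrict V x y) + shatterCount l (restrict V x y') ≤
      shatterCount (x :: l) V := by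
  classical
  rw [shatterCount_cons]
  unfold shatterCount
  induction l.sublists' with
  | nil => simp
  | cons s L ih =>
    simp only [List.countP_cons, decide_eq_true_eq]
    -- If only one restriction shatters `s`, then `V` shatters `s` by monotonicity; if both do, `V`
    -- also shatters `x :: s`.
    have key : (if Shatters s (restrict V x y) then 1 else 0) +
        (if Shatters s (restrict V x y') then 1 else 0) ≤
        (if Shatters s V then 1 else 0) + (if Shatters (x :: s) V then 1 else 0) := by
      have ha := fun h1 : Shatters s (restrict V x y) => h1.mono (restrict_subset V x y)
      have hb := fun h1 : Shatters s (restrict V x y') => h1.mono (restrict_subset V x y')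
      have hc := fun (h1 : Shatters s (restrict V x y)) (h2 : Shatters s (restrict V x y')) =>
        (show Shatters (x :: s) V from ⟨y, y', h, h1, h2⟩)
      split_ifs <;> first | omega | tauto
    omega

theorem shatterCount_pos {V : Set (X → Y)} (hV : V.Nonempty) (l : List X) :
    0 < shatterCount l V := by
  classical
  unfold shatterCount
  rw [List.countP_pos_iff]
  exact ⟨[], by simp, by rw [decide_eq_true_eq]; exact hV⟩

theorem shatterCount_le_two_pow (l : List X) (V : Set (X → Y)) :
    shatterCount l V ≤ 2 ^ l.length := by
  unfold shatterCount
  exact (List.countP_le_length).trans (by simp)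

theorem sum_pow_length_sublists (l : List X) (p : ℝ) :
    ((l.sublists').map (fun s => p ^ s.length)).sum = (1 + p) ^ l.length := by
  induction l with
  | nil => simp
  | cons x l ih =>
    have : ((l.sublists').map (fun s => p ^ s.length * p)).sum =
        ((l.sublists').map (fun s => p ^ s.length)).sum * p := List.sum_map_mul_right ..
    simp [Function.comp_def, ih, pow_succ, this]
    ring

/-- A Sauer–Shelah–Perles bound for shattered subsequences. -/
theorem shatterCount_mul_pow_le (l : List X) (V : Set (X → Y)) {D : ℕ}
    (hD : ∀ s : List X, Shatters s V → s.length ≤ D) {p : ℝ} (hp : 0 < p) (hp1 : p ≤ 1) :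
    (shatterCount l V : ℝ) * p ^ D ≤ (1 + p) ^ l.length := by
  classical
  rw [← sum_pow_length_sublists]
  unfold shatterCount
  induction l.sublists' with
  | nil => simp
  | cons s L ih =>
    simp only [List.countP_cons, decide_eq_true_eq, List.map_cons, List.sum_cons]
    push_cast
    rw [add_mul, add_comm]
    refine add_le_add ?_ ih
    -- A shattered `s` has length at most `D`, so its weight `p ^ s.length` is at least `p ^ D`
    -- because `p ≤ 1`; the weights of the other subsequences are just nonnegative.
    split_ifs with h
    · simpa using pow_le_pow_of_le_one hp.le hp1 (hD s h)
    · simpa using (pow_pos hp _).le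

/-! ### Losses on lists of labels -/

/-- The total loss on a list of labels, where `loss h y` is the loss after the labels `h`. -/
def totalLoss : (List Y → Y → ℝ) → List Y → ℝ
  | _, [] => 0
  | loss, y :: ys => loss [] y + totalLoss (fun h => loss (y :: h)) ys

theorem totalLoss_append (loss : List Y → Y → ℝ) (as bs : List Y) :
    totalLoss loss (as ++ bs) =
      totalLoss loss as + totalLoss (fun h => loss (as ++ h)) bs := by
  induction as generalizing loss with
  | nil => simp [totalLoss]
  | cons a as ih => simp [totalLoss, ih, add_assoc]

theorem totalLoss_ofFn {n : ℕ} (loss : List Y → Y → ℝ) (y : Fin n → Y) :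
    totalLoss loss (List.ofFn y) =
      ∑ t : Fin n, loss (List.ofFn (Fin.take t t.isLt.le y)) (y t) := by
  induction n generalizing loss with
  | zero => simp [totalLoss]
  | succ n ih =>
    rw [List.ofFn_succ, totalLoss, ih, Fin.sum_univ_succ]
    congr 1
    refine Finset.sum_congr rfl fun t _ => ?_
    congr 1
    exact (List.ofFn_succ (f := Fin.take t.succ t.succ.isLt.le y)).symm

open Classical in
/-- The number of mistakes of `c` on two lists of instances and labels. -/
def listMistakes (c : X → Y) (xs : List X) (ys : List Y) : ℕ :=
  (xs.zip ys).countP (fun p => c p.1 ≠ p.2)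

theorem listMistakes_append (c : X → Y) {xs : List X} {ys : List Y} (h : xs.length = ys.length)
    (xs' : List X) (ys' : List Y) :
    listMistakes c (xs ++ xs') (ys ++ ys') = listMistakes c xs ys + listMistakes c xs' ys' := by
  classical
  unfold listMistakes
  rw [List.zip_append h, List.countP_append]

open Classical in
theorem conceptMistakes_eq_sum {T : ℕ} (c : X → Y) (x : Fin T → X) (y : Fin T → Y) :
    conceptMistakes c x y = ∑ t, if c (x t) ≠ y t then 1 else 0 := by
  unfold conceptMistakes
  rw [Set.ncard_eq_toFinset_card', Set.toFinset_ofPred, Finset.card_filter]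

theorem listMistakes_ofFn {T : ℕ} (c : X → Y) (x : Fin T → X) (y : Fin T → Y) :
    listMistakes c (List.ofFn x) (List.ofFn y) = conceptMistakes c x y := by
  classical
  rw [conceptMistakes_eq_sum]
  unfold listMistakes
  induction T with
  | zero => simp
  | succ n ih =>
    rw [List.ofFn_succ, List.ofFn_succ, List.zip_cons_cons, List.countP_cons, ih,
      Fin.sum_univ_succ, add_comm]
    simp

theorem listMistakes_replicate_map (c : X → Y) (x : X) {f : Bool → Y}
    (hf : f false ≠ f true) {b : Bool} (hb : c x = f b) (z : List Bool) :
    listMistakes c (List.replicate z.length x) (z.map f) = z.count (!b) := by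
  classical
  unfold listMistakes
  induction z with
  | nil => simp
  | cons a z ih =>
    rw [List.length_cons, List.replicate_succ, List.map_cons, List.zip_cons_cons,
      List.countP_cons, ih, List.count_cons]
    congr 1
    cases a <;> cases b <;> simp [hb, hf, hf.symm]

/-! ### The expected distance of a simple random walk -/

/-- Half the expected distance from `0` after `n` steps of a simple random walk from `a`. -/
def walkDist : ℕ → ℤ → ℝ
  | 0, a => |(a : ℝ)| / 2
  | n + 1, a => (walkDist n (a + 1) + walkDist n (a - 1)) / 2

/-- The probability that a simple random walk from `a` is at `0` after `n` steps. -/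
def walkReturn : ℕ → ℤ → ℝ
  | 0, a => if a = 0 then 1 else 0
  | n + 1, a => (walkReturn n (a + 1) + walkReturn n (a - 1)) / 2

theorem walkReturn_nonneg (n : ℕ) (a : ℤ) : 0 ≤ walkReturn n a := by
  induction n generalizing a with
  | zero => unfold walkReturn; split_ifs <;> norm_num
  | succ n ih => unfold walkReturn; linarith [ih (a + 1), ih (a - 1)]

/-- The function `|a|` is the mean of its values at the two neighbours of `a`, except at `0`, where
the mean is larger by 1. Thus the expected distance grows only through visits to `0`. -/
theorem walkDist_succ (n : ℕ) (a : ℤ) :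
    walkDist (n + 1) a = walkDist n a + walkReturn n a / 2 := by
  induction n generalizing a with
  | zero =>
    simp only [walkDist, walkReturn]
    push_cast
    split_ifs with h
    · subst h; norm_num
    · rcases lt_or_gt_of_ne h with h | h
      · have : (a : ℝ) ≤ -1 := by exact_mod_cast Int.le_sub_one_of_lt h
        rw [abs_of_nonpos, abs_of_nonpos, abs_of_nonpos] <;> linarith
      · have : (1 : ℝ) ≤ a := by exact_mod_cast h
        rw [abs_of_nonneg, abs_of_nonneg, abs_of_nonneg] <;> linarith
  | succ n ih =>
    rw [walkDist, ih (a + 1), ih (a - 1), walkDist, walkReturn]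
    ring

theorem walkReturn_eq_zero {n : ℕ} {a : ℤ} (h : (n : ℤ) < |a|) : walkReturn n a = 0 := by
  induction n generalizing a with
  | zero =>
    have : a ≠ 0 := by rintro rfl; simp at h
    simp [walkReturn, this]
  | succ n ih =>
    push_cast at h
    rw [walkReturn, ih, ih]
    · norm_num
    · rcases abs_cases a with ⟨h1, h2⟩ | ⟨h1, h2⟩ <;>
        rcases abs_cases (a - 1) with ⟨h3, h4⟩ | ⟨h3, h4⟩ <;> omega
    · rcases abs_cases a with ⟨h1, h2⟩ | ⟨h1, h2⟩ <;>
        rcases abs_cases (a + 1) with ⟨h3, h4⟩ | ⟨h3, h4⟩ <;> omega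

theorem walkReturn_eq_choose (n j : ℕ) :
    walkReturn n (2 * j - n) = (n.choose j : ℝ) / 2 ^ n := by
  induction n generalizing j with
  | zero =>
    rcases Nat.eq_zero_or_pos j with rfl | h
    · simp [walkReturn]
    · rw [Nat.choose_eq_zero_of_lt h]
      simp [walkReturn, h.ne']
  | succ n ih =>
    rw [walkReturn]
    have e1 : (2 * (j : ℤ) - ((n + 1 : ℕ) : ℤ) + 1) = 2 * j - n := by push_cast; ring
    rw [e1, ih]
    rcases j with _ | j
    · rw [walkReturn_eq_zero]
      · simp [pow_succ]; ring
      · push_cast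
        rw [abs_of_nonpos] <;> omega
    · have e2 : (2 * ((j + 1 : ℕ) : ℤ) - ((n + 1 : ℕ) : ℤ) - 1) = 2 * j - n := by
        push_cast; ring
      rw [e2, ih, Nat.choose_succ_succ, pow_succ]
      push_cast
      field_simp
      ring

/-- The probability that a simple random walk is at its starting point after `2 m` steps. -/
def returnProb (m : ℕ) : ℝ := (m.centralBinom : ℝ) / 4 ^ m

theorem walkReturn_two_mul (m : ℕ) : walkReturn (2 * m) 0 = returnProb m := by
  have := walkReturn_eq_choose (2 * m) m
  rw [show (2 * (m : ℤ) - ((2 * m : ℕ) : ℤ)) = 0 by push_cast; ring] at this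
  rw [this, returnProb, Nat.centralBinom, pow_mul]
  norm_num

theorem returnProb_succ (m : ℕ) :
    (m + 1) * returnProb (m + 1) = (2 * m + 1) / 2 * returnProb m := by
  have h : ((m : ℝ) + 1) * (m + 1).centralBinom = 2 * (2 * m + 1) * m.centralBinom := by
    exact_mod_cast Nat.succ_mul_centralBinom_succ m
  unfold returnProb
  rw [mul_div_assoc', h, pow_succ]
  field_simp
  ring

/-- The step after time `2m` adds `returnProb m / 2`, which turns `m * returnProb m` into `(m + 1) *
returnProb (m + 1)`; the next step cannot lower the expected distance. -/
theorem walkDist_lower (m : ℕ) :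
    m * returnProb m ≤ walkDist (2 * m) 0 ∧
      (m + 1) * returnProb (m + 1) ≤ walkDist (2 * m + 1) 0 := by
  induction m with
  | zero => norm_num [walkDist, returnProb, Nat.centralBinom]
  | succ m ih =>
    have h1 : ((m + 1 : ℕ) : ℝ) * returnProb (m + 1) ≤ walkDist (2 * (m + 1)) 0 := by
      rw [show 2 * (m + 1) = (2 * m + 1) + 1 by ring, walkDist_succ]
      push_cast
      linarith [ih.2, walkReturn_nonneg (2 * m + 1) 0]
    refine ⟨h1, ?_⟩
    rw [walkDist_succ, walkReturn_two_mul, returnProb_succ]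
    push_cast at h1 ⊢
    linarith

/-- The left factor `m * returnProb m ^ 2` is nondecreasing for `m ≥ 1` and starts at 1/4, which
avoids Stirling's formula. -/
theorem one_le_returnProb_sq (m : ℕ) : 1 ≤ 4 * ((m : ℝ) + 1) * returnProb (m + 1) ^ 2 := by
  induction m with
  | zero => norm_num [returnProb, Nat.centralBinom, Nat.choose]
  | succ m ih =>
    have h := returnProb_succ (m + 1)
    push_cast at h ⊢
    have hm : (0 : ℝ) ≤ m := m.cast_nonneg
    have h2 : returnProb (m + 1 + 1) =
        (2 * (m + 1) + 1) / (2 * (m + 1 + 1)) * returnProb (m + 1) := by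
      field_simp
      linarith
    rw [h2]
    refine ih.trans ?_
    rw [mul_pow, ← mul_assoc]
    refine mul_le_mul_of_nonneg_right ?_ (sq_nonneg _)
    rw [div_pow, mul_div_assoc', le_div_iff₀ (by positivity)]
    nlinarith

theorem sqrt_le_mul_returnProb {m : ℕ} (hm : 1 ≤ m) :
    Real.sqrt m / 2 ≤ m * returnProb m := by
  obtain ⟨m, rfl⟩ := Nat.exists_eq_add_of_le' hm
  have h := one_le_returnProb_sq m
  have h0 : 0 ≤ returnProb (m + 1) := by unfold returnProb; positivity
  push_cast
  have hm0 : (0 : ℝ) ≤ m := m.cast_nonneg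
  rw [div_le_iff₀ two_pos]
  refine Real.sqrt_le_iff.2 ⟨by positivity, ?_⟩
  nlinarith [mul_le_mul_of_nonneg_left h (by positivity : (0 : ℝ) ≤ m + 1)]

theorem sqrt_le_walkDist_odd (m : ℕ) :
    Real.sqrt (m + 1 : ℕ) / 2 ≤ walkDist (2 * m + 1) 0 := by
  refine (sqrt_le_mul_returnProb (Nat.le_add_left 1 m)).trans ?_
  push_cast
  exact (walkDist_lower m).2

theorem sqrt_le_walkDist_even {m : ℕ} (hm : 1 ≤ m) :
    Real.sqrt m / 2 ≤ walkDist (2 * m) 0 :=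
  (sqrt_le_mul_returnProb hm).trans (walkDist_lower m).1

/-- The bound lies on the line through the origin and the even bound `√m / 2` at length `2m`, so
bounds for blocks of lengths `2m` and `2m + 1` add up to a multiple of the total length. -/
theorem linear_le_walkDist_odd {m : ℕ} (hm : 1 ≤ m) :
    (2 * m + 1) * (Real.sqrt m / (4 * m)) ≤ walkDist (2 * m + 1) 0 := by
  refine le_trans ?_ (walkDist_lower m).2
  rw [returnProb_succ]
  have h := sqrt_le_mul_returnProb hm
  have hm0 : (0 : ℝ) < m := by exact_mod_cast hm
  have : Real.sqrt m / (4 * m) ≤ returnProb m / 2 := by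
    rw [div_le_iff₀ (by positivity)]
    linarith
  nlinarith [mul_le_mul_of_nonneg_left this (by positivity : (0 : ℝ) ≤ 2 * m + 1)]

/-- Block lengths for the lower bound: `D` blocks of almost equal length. -/
theorem exists_block_lengths {D T : ℕ} (hD : 1 ≤ D) (hDT : D ≤ T) :
    ∃ ks : List ℕ, ks.length = D ∧ ks.sum = T ∧
      Real.sqrt (T * D / 8) ≤ (ks.map (fun k => walkDist k 0)).sum := by
  have hDr : (0 : ℝ) < D := by exact_mod_cast hD
  have hmod := Nat.mod_lt T hD
  have hdm := Nat.mod_add_div T D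
  set q := T / D with hq
  set r := T % D with hr
  have hq1 : 1 ≤ q := (Nat.one_le_div_iff hD).2 hDT
  refine ⟨List.replicate r (q + 1) ++ List.replicate (D - r) q, ?_, ?_, ?_⟩
  · simp; omega
  · simp only [List.sum_append, List.sum_replicate, smul_eq_mul]
    obtain ⟨e, he⟩ : ∃ e, D = r + e := ⟨D - r, by omega⟩
    rw [show D - r = e by omega]
    rw [he] at hdm
    linarith
  · simp only [List.map_append, List.map_replicate, List.sum_append, List.sum_replicate,
      nsmul_eq_mul]
    rw [Nat.cast_sub hmod.le]
    have hr0 : (0 : ℝ) ≤ r := r.cast_nonneg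
    have hrD : (r : ℝ) ≤ D := by exact_mod_cast hmod.le
    have hT : (T : ℝ) = r + D * q := by exact_mod_cast hdm.symm
    -- For `q = 2m` the linear bounds sum to `T / (4√m)`, and `T ≥ 2mD` suffices. For `q = 2m + 1`
    -- every block contributes at least `√(m+1) / 2`, and `T ≤ 2(m+1)D` suffices.
    rcases Nat.even_or_odd' q with ⟨m, hm | hm⟩
    · have hm1 : 1 ≤ m := by omega
      have hm0 : (0 : ℝ) < m := by exact_mod_cast hm1
      rw [hm] at hT ⊢
      have h1 := linear_le_walkDist_odd hm1
      have h2 := sqrt_le_walkDist_even hm1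
      push_cast at hT
      set s := Real.sqrt m with hs
      have hs0 : 0 < s := Real.sqrt_pos.2 hm0
      have hss : s * s = m := Real.mul_self_sqrt hm0.le
      have h3 : s / 2 = (2 * m) * (s / (4 * m)) := by field_simp; ring
      have h4 : (T : ℝ) * (s / (4 * m)) ≤
          r * walkDist (2 * m + 1) 0 + (D - r) * walkDist (2 * m) 0 := by
        have h5 := mul_le_mul_of_nonneg_left h1 hr0
        have h6 := mul_le_mul_of_nonneg_left h2 (sub_nonneg.2 hrD)
        rw [h3] at h6
        rw [hT]
        linarith
      refine le_trans ?_ h4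
      refine Real.sqrt_le_iff.2 ⟨by positivity, ?_⟩
      have h7 : ((T : ℝ) * (s / (4 * m))) ^ 2 = T ^ 2 / (16 * m) := by
        rw [mul_pow, div_pow, sq s, hss]
        field_simp
        ring
      rw [h7, div_le_div_iff₀ (by norm_num) (by positivity)]
      have h8 : 2 * (m : ℝ) * D ≤ T := by rw [hT]; nlinarith
      nlinarith [mul_le_mul_of_nonneg_left h8 (Nat.cast_nonneg (α := ℝ) T)]
    · rw [hm] at hT ⊢
      have h1 := sqrt_le_walkDist_odd m
      have h2 := sqrt_le_walkDist_even (Nat.le_add_left 1 m)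
      push_cast at hT
      have h4 : (D : ℝ) * (Real.sqrt (m + 1 : ℕ) / 2) ≤
          r * walkDist (2 * m + 1 + 1) 0 + (D - r) * walkDist (2 * m + 1) 0 := by
        have h5 := mul_le_mul_of_nonneg_left h2 hr0
        have h6 := mul_le_mul_of_nonneg_left h1 (sub_nonneg.2 hrD)
        rw [show 2 * m + 1 + 1 = 2 * (m + 1) by ring]
        linarith
      refine le_trans ?_ h4
      refine Real.sqrt_le_iff.2 ⟨by positivity, ?_⟩
      rw [mul_pow, div_pow, Real.sq_sqrt (Nat.cast_nonneg _)]
      push_cast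
      nlinarith

/-! ### The adversary -/

/-- Two different labels cannot both be predicted with probability more than one half. -/
def FairLoss (loss : List Y → Y → ℝ) : Prop :=
  ∀ h y y', y ≠ y' → 1 ≤ loss h y + loss h y'

/-- Method of conditional expectations. Here `a` is the lead of `true` over `false` so far; the
losses of the two possible next labels sum to at least 1, so for one of them the loss minus 1/2 plus
the new `walkDist` is at least the old `walkDist`. -/
theorem exists_labels_walkDist {f : Bool → Y} (hf : f false ≠ f true) (n : ℕ) (a : ℤ)
    {loss : List Y → Y → ℝ} (hloss : FairLoss loss) :
    ∃ z : List Bool, z.length = n ∧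
      walkDist n a ≤ totalLoss loss (z.map f) - n / 2 +
        |(a : ℝ) + z.count true - z.count false| / 2 := by
  induction n generalizing a loss with
  | zero => exact ⟨[], rfl, by simp [walkDist, totalLoss]⟩
  | succ n ih =>
    obtain ⟨z, hz, h⟩ := ih (a + 1) (loss := fun h => loss (f true :: h)) (fun h => hloss _)
    obtain ⟨z', hz', h'⟩ := ih (a - 1) (loss := fun h => loss (f false :: h)) (fun h => hloss _)
    have h0 := hloss [] _ _ hf
    have key : walkDist (n + 1) a = (walkDist n (a + 1) + walkDist n (a - 1)) / 2 := rfl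
    by_cases hc : walkDist (n + 1) a ≤ loss [] (f true) - 1 / 2 + walkDist n (a + 1)
    · refine ⟨true :: z, by simp [hz], ?_⟩
      rw [List.map_cons, totalLoss, List.count_cons_self, List.count_cons_of_ne (by decide)]
      push_cast at h ⊢
      rw [show (a : ℝ) + (z.count true + 1) = a + 1 + z.count true by ring]
      linarith
    · refine ⟨false :: z', by simp [hz'], ?_⟩
      rw [List.map_cons, totalLoss, List.count_cons_self, List.count_cons_of_ne (by decide)]
      push_cast at h' ⊢
      rw [show (a : ℝ) + z'.count true - (z'.count false + 1) =
        a - 1 + z'.count true - z'.count false by ring]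
      linarith

/-- With `b` the majority bit, the minority count is `n / 2` minus half the difference of the
counts. -/
theorem exists_block_labels {f : Bool → Y} (hf : f false ≠ f true) (n : ℕ)
    {loss : List Y → Y → ℝ} (hloss : FairLoss loss) :
    ∃ (z : List Bool) (b : Bool), z.length = n ∧
      (z.count (!b) : ℝ) + walkDist n 0 ≤ totalLoss loss (z.map f) := by
  obtain ⟨z, hz, h⟩ := exists_labels_walkDist hf n 0 hloss
  have hlen : (z.count true : ℝ) + z.count false = n := by
    rw [← hz]
    exact_mod_cast List.count_true_add_count_false z
  rw [Int.cast_zero, zero_add] at h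
  rcases abs_cases ((z.count true : ℝ) - z.count false) with ⟨h1, -⟩ | ⟨h1, -⟩
  · exact ⟨z, true, hz, by rw [Bool.not_true]; linarith⟩
  · exact ⟨z, false, hz, by rw [Bool.not_false]; linarith⟩

theorem exists_labels_blocks (bl : List (X × ℕ)) {V : Set (X → Y)}
    (hV : Shatters (bl.map Prod.fst) V) {loss : List Y → Y → ℝ} (hloss : FairLoss loss) :
    ∃ ys : List Y, ys.length = (bl.map Prod.snd).sum ∧ ∃ c ∈ V,
      (listMistakes c (bl.flatMap fun p => List.replicate p.2 p.1) ys : ℝ) +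
        (bl.map fun p => walkDist p.2 0).sum ≤ totalLoss loss ys := by
  induction bl generalizing V loss with
  | nil =>
    obtain ⟨c, hc⟩ := hV
    exact ⟨[], rfl, c, hc, by simp [listMistakes, totalLoss]⟩
  | cons p bl ih =>
    obtain ⟨x, k⟩ := p
    obtain ⟨y, y', hne, h, h'⟩ := hV
    set f : Bool → Y := fun b => bif b then y' else y with hfdef
    have hf : f false ≠ f true := hne
    obtain ⟨z, b, hz, hzb⟩ := exists_block_labels hf k hloss
    -- The next blocks are played in the subtree of the majority label, so the final concept errs in
    -- this block only on the minority labels.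
    have hb : Shatters (bl.map Prod.fst) (restrict V x (f b)) := by
      cases b
      · exact h
      · exact h'
    obtain ⟨ys, hys, c, hc, hle⟩ :=
      ih hb (loss := fun h => loss (z.map f ++ h)) (fun h => hloss _)
    refine ⟨z.map f ++ ys, by simp [hz, hys], c, hc.1, ?_⟩
    rw [totalLoss_append, List.flatMap_cons, listMistakes_append _ (by simp [hz])]
    have := listMistakes_replicate_map c x hf hc.2 z
    rw [hz] at this
    simp only [this, List.map_cons, List.sum_cons]
    push_cast
    linarith

/-! ### The lower bound on the regret -/

section Learner

theorem bestMistakes_le {T : ℕ} {C : Set (X → Y)} {c : X → Y} (hc : c ∈ C) (x : Fin T → X)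
    (y : Fin T → Y) : bestMistakes C x y ≤ conceptMistakes c x y :=
  ciInf_le (f := fun c : C => conceptMistakes (c : X → Y) x y) ⟨0, fun _ _ => Nat.zero_le _⟩
    ⟨c, hc⟩

variable [MeasurableSpace Y]

theorem integral_indicator_ne [MeasurableSingletonClass Y] (μ : ProbabilityMeasure Y) (y : Y) :
    ∫ p : Y, Set.indicator {p : Y | p ≠ y} (fun _ => (1 : ℝ)) p ∂(μ : Measure Y) =
      1 - (μ : Measure Y).real {y} := by
  have hm : MeasurableSet {p : Y | p ≠ y} := (measurableSet_singleton y).compl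
  rw [integral_indicator hm, setIntegral_const, smul_eq_mul, mul_one]
  exact probReal_compl_eq_one_sub (measurableSet_singleton y)

/-- The probability of a wrong prediction of the label `y` after the labels `h`. -/
def learnerLoss {T : ℕ} (A : Learner X Y T) (x : Fin T → X) (h : List Y) (y : Y) : ℝ :=
  -- The value 1 past the horizon keeps `FairLoss` true for histories of every length.
  if H : h.length < T then 1 - (A x ⟨h.length, H⟩ h.get : Measure Y).real {y} else 1

theorem fairLoss_learnerLoss [MeasurableSingletonClass Y] {T : ℕ} (A : Learner X Y T) (x : Fin T → X) :
    FairLoss (learnerLoss A x) := by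
  intro h y y' hne
  unfold learnerLoss
  split_ifs with H
  · set μ : Measure Y := (A x ⟨h.length, H⟩ h.get : Measure Y)
    have : μ.real ({y} ∪ {y'}) = μ.real {y} + μ.real {y'} :=
      measureReal_union (Set.disjoint_singleton.2 hne) (measurableSet_singleton y')
    have h1 : μ.real ({y} ∪ {y'}) ≤ 1 := measureReal_le_one
    linarith
  · norm_num

theorem learnerLoss_ofFn {T : ℕ} (A : Learner X Y T) (x : Fin T → X) (t : Fin T)
    (v : Fin t → Y) (y : Y) :
    learnerLoss A x (List.ofFn v) y = 1 - (A x t v : Measure Y).real {y} := by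
  have key : ∀ (n : ℕ) (hn : n = t) (H : n < T) (w : Fin n → Y)
      (_ : ∀ i, w i = v (Fin.cast hn i)), A x ⟨n, H⟩ w = A x t v := by
    rintro n rfl H w hw
    congr 1
    exact funext hw
  unfold learnerLoss
  rw [dif_pos (by simp)]
  rw [key _ (List.length_ofFn) _ _ (fun i => by simp; rfl)]

theorem totalLoss_learnerLoss [MeasurableSingletonClass Y] {T : ℕ} (A : Learner X Y T) (x : Fin T → X) (y : Fin T → Y) :
    totalLoss (learnerLoss A x) (List.ofFn y) = expectedMistakes A x y := by
  rw [totalLoss_ofFn]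
  unfold expectedMistakes
  refine Finset.sum_congr rfl fun t _ => ?_
  rw [learnerLoss_ofFn, integral_indicator_ne]

theorem le_regret {T : ℕ} {C : Set (X → Y)} (A : Learner X Y T) {x : Fin T → X} {y : Fin T → Y}
    {c : X → Y} (hc : c ∈ C) {r : ℝ} (h : conceptMistakes c x y + r ≤ expectedMistakes A x y) :
    (r : EReal) ≤ regret A C := by
  refine le_trans ?_ (le_iSup₂ (f := fun (x : Fin T → X) (y : Fin T → Y) =>
    ((expectedMistakes A x y - (bestMistakes C x y : ℝ) : ℝ) : EReal)) x y)
  have : (bestMistakes C x y : ℝ) ≤ conceptMistakes c x y := by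
    exact_mod_cast bestMistakes_le hc x y
  exact EReal.coe_le_coe_iff.2 (by linarith)

theorem zero_le_regret [Nonempty X] {T : ℕ} {C : Set (X → Y)} (hC : C.Nonempty)
    (A : Learner X Y T) : ((0 : ℝ) : EReal) ≤ regret A C := by
  obtain ⟨c, hc⟩ := hC
  obtain ⟨x₀⟩ := ‹Nonempty X›
  refine le_regret A (x := fun _ => x₀) (y := fun _ => c x₀) hc ?_
  have : conceptMistakes c (fun _ : Fin T => x₀) (fun _ => c x₀) = 0 := by
    simp [conceptMistakes]
  rw [this]
  simp only [Nat.cast_zero, add_zero]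
  exact Finset.sum_nonneg fun t _ => integral_nonneg fun p =>
    Set.indicator_nonneg (fun _ _ => zero_le_one) p

theorem sqrt_le_optimalRegret [MeasurableSingletonClass Y] [Nonempty X] {T D : ℕ} {C : Set (X → Y)} (hC : C.Nonempty)
    (hDT : D ≤ T) {l : List X} (hl : l.length = D) (hlC : Shatters l C) :
    ((Real.sqrt (T * D / 8) : ℝ) : EReal) ≤ optimalRegret T C := by
  refine le_iInf fun A => ?_
  rcases Nat.eq_zero_or_pos D with rfl | hD
  · simpa using zero_le_regret hC A
  obtain ⟨ks, hlen, hsum, hks⟩ := exists_block_lengths hD hDT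
  have hfst : (l.zip ks).map Prod.fst = l := List.map_fst_zip (by omega)
  have hsnd : (l.zip ks).map Prod.snd = ks := List.map_snd_zip (by omega)
  have hxs : ((l.zip ks).flatMap fun p => List.replicate p.2 p.1).length = T := by
    rw [List.length_flatMap]
    simp only [List.length_replicate]
    change ((l.zip ks).map Prod.snd).sum = T
    rw [hsnd, hsum]
  obtain ⟨x, hx⟩ : ∃ x : Fin T → X,
      ((l.zip ks).flatMap fun p => List.replicate p.2 p.1) = List.ofFn x := by
    generalize ((l.zip ks).flatMap fun p => List.replicate p.2 p.1) = xs at hxs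
    subst hxs
    exact ⟨xs.get, (List.ofFn_get xs).symm⟩
  obtain ⟨ys, hys, c, hc, h⟩ :=
    exists_labels_blocks (l.zip ks) (V := C) (by rwa [hfst]) (fairLoss_learnerLoss A x)
  rw [hsnd, hsum] at hys
  obtain ⟨y, rfl⟩ : ∃ y : Fin T → Y, ys = List.ofFn y := by
    subst hys
    exact ⟨ys.get, (List.ofFn_get ys).symm⟩
  rw [hx, listMistakes_ofFn, totalLoss_learnerLoss] at h
  have hw : ((l.zip ks).map fun p => walkDist p.2 0) = ks.map fun k => walkDist k 0 := by
    conv_rhs => rw [← hsnd]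
    rw [List.map_map]
    rfl
  rw [hw] at h
  exact le_regret A hc (by linarith)

end Learner

/-! ### Experts -/

/-- A maximum exists even for infinite `Y`, since the counts are natural numbers bounded by `2 ^
l.length`. -/
theorem exists_shatterCount_max [Nonempty Y] (V : Set (X → Y)) (x : X) (l : List X) :
    ∃ y, ∀ y', shatterCount l (restrict V x y') ≤ shatterCount l (restrict V x y) := by
  obtain ⟨y, hy⟩ := Nat.sSup_mem (s := Set.range fun y => shatterCount l (restrict V x y))
    (Set.range_nonempty _)
    ⟨2 ^ l.length, by rintro _ ⟨y, rfl⟩; exact shatterCount_le_two_pow _ _⟩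
  refine ⟨y, fun y' => ?_⟩
  simp only at hy
  rw [hy]
  exact le_csSup ⟨2 ^ l.length, by rintro _ ⟨y, rfl⟩; exact shatterCount_le_two_pow _ _⟩
    ⟨y', rfl⟩

/-- A label `y` of `x` for which the number of subsequences of `l` shattered by the concepts with
value `y` at `x` is as large as possible. -/
def bestLabel [Nonempty Y] (V : Set (X → Y)) (x : X) (l : List X) : Y :=
  Classical.choose (exists_shatterCount_max V x l)

theorem two_mul_shatterCount_restrict_le [Nonempty Y] {V : Set (X → Y)} {x : X} {l : List X}
    {y : Y} (h : bestLabel V x l ≠ y) :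
    2 * shatterCount l (restrict V x y) ≤ shatterCount (x :: l) V := by
  have h1 := Classical.choose_spec (exists_shatterCount_max V x l) y
  have h2 := shatterCount_restrict_add_le (x := x) (l := l) (V := V) h
  unfold bestLabel at h2
  omega

/-- The concepts of `C` that agree with the labels of the rounds of `I` before round `n`. -/
def versionSpace {T : ℕ} (C : Set (X → Y)) (x : Fin T → X) (I : Finset (Fin T)) (y : Fin T → Y)
    (n : ℕ) : Set (X → Y) :=
  {c ∈ C | ∀ s : Fin T, (s : ℕ) < n → s ∈ I → c (x s) = y s}

theorem versionSpace_congr {T : ℕ} {C : Set (X → Y)} {x : Fin T → X} {I I' : Finset (Fin T)}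
    {y y' : Fin T → Y} {n : ℕ} (hI : ∀ s : Fin T, (s : ℕ) < n → (s ∈ I ↔ s ∈ I'))
    (hy : ∀ s : Fin T, (s : ℕ) < n → y s = y' s) :
    versionSpace C x I y n = versionSpace C x I' y' n := by
  ext c
  refine and_congr Iff.rfl (forall_congr' fun s => forall_congr' fun hs => ?_)
  rw [hI s hs, hy s hs]

theorem versionSpace_zero {T : ℕ} (C : Set (X → Y)) (x : Fin T → X) (I : Finset (Fin T))
    (y : Fin T → Y) : versionSpace C x I y 0 = C := by
  ext c
  simp [versionSpace]

theorem versionSpace_succ_of_mem {T : ℕ} (C : Set (X → Y)) (x : Fin T → X) {I : Finset (Fin T)}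
    (y : Fin T → Y) {t : Fin T} (ht : t ∈ I) :
    versionSpace C x I y (t + 1) = restrict (versionSpace C x I y t) (x t) (y t) := by
  ext c
  constructor
  · rintro ⟨hc, h⟩
    exact ⟨⟨hc, fun s hs => h s (by omega)⟩, h t (by omega) ht⟩
  · rintro ⟨⟨hc, h⟩, ht'⟩
    refine ⟨hc, fun s hs hsI => ?_⟩
    rcases Nat.lt_succ_iff_lt_or_eq.1 hs with h1 | h1
    · exact h s h1 hsI
    · rwa [Fin.ext h1]

theorem versionSpace_succ_of_notMem {T : ℕ} (C : Set (X → Y)) (x : Fin T → X)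
    {I : Finset (Fin T)} (y : Fin T → Y) {t : Fin T} (ht : t ∉ I) :
    versionSpace C x I y (t + 1) = versionSpace C x I y t := by
  ext c
  constructor
  · rintro ⟨hc, h⟩
    exact ⟨hc, fun s hs => h s (by omega)⟩
  · rintro ⟨hc, h⟩
    refine ⟨hc, fun s hs hsI => ?_⟩
    rcases Nat.lt_succ_iff_lt_or_eq.1 hs with h1 | h1
    · exact h s h1 hsI
    · exact absurd (Fin.ext h1 ▸ hsI) ht

/-- The prediction in round `t` of the expert that takes account of the labels revealed in the
rounds of `I`. -/
def expert [Nonempty Y] {T : ℕ} (C : Set (X → Y)) (x : Fin T → X) (I : Finset (Fin T))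
    (y : Fin T → Y) (t : Fin T) : Y :=
  bestLabel (versionSpace C x I y t) (x t) ((List.ofFn x).drop (t + 1))

theorem expert_congr [Nonempty Y] {T : ℕ} {C : Set (X → Y)} {x : Fin T → X}
    {I I' : Finset (Fin T)} {y y' : Fin T → Y} {t : Fin T}
    (hI : ∀ s : Fin T, s < t → (s ∈ I ↔ s ∈ I')) (hy : ∀ s : Fin T, s < t → y s = y' s) :
    expert C x I y t = expert C x I' y' t := by
  unfold expert
  rw [versionSpace_congr hI hy]

/-- The condition on `I` refers to the expert of `I` itself, but whether `t` belongs to `I` depends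
only on the members before `t`; hence `I` is built round by round. -/
theorem exists_expert_rounds [Nonempty Y] {T : ℕ} (C : Set (X → Y)) (x : Fin T → X)
    (y : Fin T → Y) (c : X → Y) :
    ∃ I : Finset (Fin T), ∀ t, t ∈ I ↔ c (x t) = y t ∧ expert C x I y t ≠ y t := by
  classical
  suffices h : ∀ n : ℕ, ∃ I : Finset (Fin T), (∀ t ∈ I, (t : ℕ) < n) ∧
      ∀ t : Fin T, (t : ℕ) < n → (t ∈ I ↔ c (x t) = y t ∧ expert C x I y t ≠ y t) by
    obtain ⟨I, -, hI⟩ := h T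
    exact ⟨I, fun t => hI t t.isLt⟩
  intro n
  induction n with
  | zero => exact ⟨∅, by simp, by simp⟩
  | succ n ih =>
    obtain ⟨I, h1, h2⟩ := ih
    set J : Finset (Fin T) :=
      I ∪ Finset.univ.filter fun t => (t : ℕ) = n ∧ c (x t) = y t ∧ expert C x I y t ≠ y t
      with hJ
    have hmem : ∀ t : Fin T, t ∈ J ↔
        t ∈ I ∨ ((t : ℕ) = n ∧ c (x t) = y t ∧ expert C x I y t ≠ y t) := by
      intro t; simp [hJ]
    have hexp : ∀ t : Fin T, (t : ℕ) < n + 1 → expert C x J y t = expert C x I y t := by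
      intro t ht
      refine expert_congr (fun s hs => ?_) (fun _ _ => rfl)
      rw [hmem]
      have : (s : ℕ) ≠ n := by have : (s : ℕ) < t := hs; omega
      tauto
    refine ⟨J, fun t ht => ?_, fun t ht => ?_⟩
    · rcases (hmem t).1 ht with h | h
      · exact (h1 t h).trans (Nat.lt_succ_self n)
      · omega
    · rw [hexp t ht, hmem]
      rcases Nat.lt_succ_iff_lt_or_eq.1 ht with h | h
      · rw [h2 t h]
        have : (t : ℕ) ≠ n := by omega
        tauto
      · have : t ∉ I := fun h' => by have := h1 t h'; omega
        tauto

/-- Each round of `I` at least halves the count. In the other rounds an instance is dropped with the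
version space unchanged, which cannot raise it. -/
theorem two_pow_card_mul_le [Nonempty Y] {T : ℕ} (C : Set (X → Y)) (x : Fin T → X)
    (y : Fin T → Y) {I : Finset (Fin T)} (hI : ∀ t ∈ I, expert C x I y t ≠ y t) {n : ℕ}
    (hn : n ≤ T) :
    2 ^ (I.filter fun t : Fin T => (t : ℕ) < n).card *
      shatterCount ((List.ofFn x).drop n) (versionSpace C x I y n) ≤
        shatterCount (List.ofFn x) C := by
  induction n with
  | zero => simp [versionSpace_zero]
  | succ n ih =>
    refine le_trans ?_ (ih (Nat.le_of_succ_le hn))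
    set t : Fin T := ⟨n, hn⟩ with ht
    have hdrop : (List.ofFn x).drop n = x t :: (List.ofFn x).drop (n + 1) := by
      rw [List.drop_eq_getElem_cons (by simpa using hn)]
      simp [ht]
    rw [hdrop]
    by_cases hmem : t ∈ I
    · have hfil : (I.filter fun s : Fin T => (s : ℕ) < n + 1) =
          insert t (I.filter fun s : Fin T => (s : ℕ) < n) := by
        ext s
        simp only [Finset.mem_filter, Finset.mem_insert]
        constructor
        · rintro ⟨h1, h2⟩
          rcases Nat.lt_succ_iff_lt_or_eq.1 h2 with h | h
          · exact Or.inr ⟨h1, h⟩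
          · exact Or.inl (Fin.ext h)
        · rintro (rfl | ⟨h1, h2⟩)
          · exact ⟨hmem, Nat.lt_succ_self n⟩
          · exact ⟨h1, h2.trans (Nat.lt_succ_self n)⟩
      rw [hfil, Finset.card_insert_of_notMem (by simp [ht]), pow_succ, mul_assoc]
      refine Nat.mul_le_mul_left _ ?_
      rw [show n + 1 = (t : ℕ) + 1 from rfl, versionSpace_succ_of_mem C x y hmem]
      exact two_mul_shatterCount_restrict_le (hI t hmem)
    · have hfil : (I.filter fun s : Fin T => (s : ℕ) < n + 1) = I.filter fun s : Fin T => (s : ℕ) < n := by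
        refine Finset.filter_congr fun s hs => ?_
        have : (s : ℕ) ≠ n := fun h => hmem (by rwa [show t = s from Fin.ext h.symm])
        omega
      rw [hfil, show n + 1 = (t : ℕ) + 1 from rfl, versionSpace_succ_of_notMem C x y hmem]
      exact Nat.mul_le_mul_left _ (shatterCount_le_cons _ _ _)

open Classical in
/-- Some expert that uses few rounds makes few more mistakes than `c`. -/
theorem exists_expert [Nonempty Y] {T : ℕ} {C : Set (X → Y)} (x : Fin T → X)
    (y : Fin T → Y) {c : X → Y} (hc : c ∈ C) :
    ∃ I : Finset (Fin T), 2 ^ I.card ≤ shatterCount (List.ofFn x) C ∧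
      (∑ t, if expert C x I y t ≠ y t then 1 else 0) ≤ conceptMistakes c x y + I.card := by
  obtain ⟨I, hI⟩ := exists_expert_rounds C x y c
  refine ⟨I, ?_, ?_⟩
  · have h := two_pow_card_mul_le C x y (fun t ht => ((hI t).1 ht).2) le_rfl
    rw [Finset.filter_true_of_mem (fun t _ => t.isLt)] at h
    have hV : (versionSpace C x I y T).Nonempty := ⟨c, hc, fun s _ hs => ((hI s).1 hs).1⟩
    exact (Nat.le_mul_of_pos_right _ (shatterCount_pos hV _)).trans h
  · rw [conceptMistakes_eq_sum, ← Finset.card_filter, ← Finset.card_filter]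
    refine (Finset.card_le_card fun t ht => ?_).trans (Finset.card_union_le _ _)
    rw [Finset.mem_union, hI t]
    simp only [Finset.mem_filter, Finset.mem_univ, true_and] at ht ⊢
    tauto

/-! ### Exponential weights -/

/-- Hoeffding's lemma for a Bernoulli variable. -/
theorem bernoulli_mgf_le {q : ℝ} (h0 : 0 ≤ q) (h1 : q ≤ 1) (η : ℝ) :
    1 - q + q * Real.exp (-η) ≤ Real.exp (-η * q + η ^ 2 / 8) := by
  -- The law of a Bernoulli variable with mean `q`, to which the sub-Gaussian bound for variables in
  -- `[0, 1]` applies at `-η`.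
  set μ : Measure ℝ := ENNReal.ofReal q • Measure.dirac 1 +
    ENNReal.ofReal (1 - q) • Measure.dirac 0 with hμ
  have hint : ∀ f : ℝ → ℝ, ∫ z, f z ∂μ = q * f 1 + (1 - q) * f 0 := by
    intro f
    rw [hμ, integral_add_measure, integral_smul_measure, integral_smul_measure, integral_dirac,
      integral_dirac, ENNReal.toReal_ofReal h0, ENNReal.toReal_ofReal (by linarith)]
    · simp
    · exact (integrable_dirac (by simp)).smul_measure ENNReal.ofReal_ne_top
    · exact (integrable_dirac (by simp)).smul_measure ENNReal.ofReal_ne_top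
  have hprob : IsProbabilityMeasure μ := by
    constructor
    rw [hμ]
    simp only [Measure.coe_add, Measure.coe_smul, Pi.add_apply, Pi.smul_apply, measure_univ,
      smul_eq_mul, mul_one]
    rw [← ENNReal.ofReal_add h0 (by linarith)]
    simp
  have hIcc : ∀ᵐ z ∂μ, (id z : ℝ) ∈ Set.Icc (0 : ℝ) 1 := by
    rw [hμ, ae_add_measure_iff]
    constructor
    · refine Measure.ae_smul_measure ?_ _
      rw [ae_dirac_iff (show MeasurableSet {z : ℝ | id z ∈ Set.Icc (0 : ℝ) 1} from
        measurableSet_Icc)]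
      simp
    · refine Measure.ae_smul_measure ?_ _
      rw [ae_dirac_iff (show MeasurableSet {z : ℝ | id z ∈ Set.Icc (0 : ℝ) 1} from
        measurableSet_Icc)]
      simp
  have h := (ProbabilityTheory.hasSubgaussianMGF_of_mem_Icc (μ := μ) (X := id)
    aemeasurable_id hIcc).mgf_le (-η)
  rw [ProbabilityTheory.mgf, hint, hint] at h
  simp only [id] at h
  have e1 : -η * (1 - (q * 1 + (1 - q) * 0)) = -η + η * q := by ring
  have e2 : -η * (0 - (q * 1 + (1 - q) * 0)) = η * q := by ring
  have e3 : (((‖(1 : ℝ) - 0‖₊ / 2) ^ 2 : NNReal) : ℝ) * (-η) ^ 2 / 2 = η ^ 2 / 8 := by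
    push_cast
    norm_num
    ring
  rw [e1, e2, e3, Real.exp_add] at h
  refine le_of_mul_le_mul_right ?_ (Real.exp_pos (η * q))
  rw [← Real.exp_add, show -η * q + η ^ 2 / 8 + η * q = η ^ 2 / 8 by ring]
  linarith

section Hedge

variable {ι : Type*} [Fintype ι]

/-- The exponential weight of the expert `i` before round `n`, with initial weights `w` and losses
`ℓ`. -/
def hedgeWeight (w : ι → ℝ) (η : ℝ) (ℓ : ι → ℕ → ℝ) (n : ℕ) (i : ι) : ℝ :=
  w i * Real.exp (-η * ∑ s ∈ Finset.range n, ℓ i s)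

/-- The normalized exponential weights. -/
def hedgeProb (w : ι → ℝ) (η : ℝ) (ℓ : ι → ℕ → ℝ) (n : ℕ) (i : ι) : ℝ :=
  hedgeWeight w η ℓ n i / ∑ j, hedgeWeight w η ℓ n j

theorem hedgeWeight_pos {ι : Type*} {w : ι → ℝ} (hw : ∀ i, 0 < w i) (η : ℝ) (ℓ : ι → ℕ → ℝ)
    (n : ℕ) (i : ι) : 0 < hedgeWeight w η ℓ n i :=
  mul_pos (hw i) (Real.exp_pos _)

theorem hedgeWeight_congr {ι : Type*} (w : ι → ℝ) (η : ℝ) {ℓ ℓ' : ι → ℕ → ℝ} {n : ℕ}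
    (h : ∀ i, ∀ s < n, ℓ i s = ℓ' i s) : hedgeWeight w η ℓ n = hedgeWeight w η ℓ' n := by
  funext i
  unfold hedgeWeight
  rw [Finset.sum_congr rfl fun s hs => h i s (Finset.mem_range.1 hs)]

theorem hedgeProb_congr (w : ι → ℝ) (η : ℝ) {ℓ ℓ' : ι → ℕ → ℝ} {n : ℕ}
    (h : ∀ i, ∀ s < n, ℓ i s = ℓ' i s) : hedgeProb w η ℓ n = hedgeProb w η ℓ' n := by
  unfold hedgeProb
  rw [hedgeWeight_congr w η h]

theorem sum_hedgeWeight_pos [Nonempty ι] {w : ι → ℝ} (hw : ∀ i, 0 < w i) (η : ℝ)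
    (ℓ : ι → ℕ → ℝ) (n : ℕ) : 0 < ∑ i, hedgeWeight w η ℓ n i :=
  Finset.sum_pos (fun i _ => hedgeWeight_pos hw η ℓ n i) Finset.univ_nonempty

theorem hedgeProb_nonneg [Nonempty ι] {w : ι → ℝ} (hw : ∀ i, 0 < w i) (η : ℝ)
    (ℓ : ι → ℕ → ℝ) (n : ℕ) (i : ι) : 0 ≤ hedgeProb w η ℓ n i :=
  div_nonneg (hedgeWeight_pos hw η ℓ n i).le (sum_hedgeWeight_pos hw η ℓ n).le

theorem sum_hedgeProb [Nonempty ι] {w : ι → ℝ} (hw : ∀ i, 0 < w i) (η : ℝ)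
    (ℓ : ι → ℕ → ℝ) (n : ℕ) : ∑ i, hedgeProb w η ℓ n i = 1 := by
  unfold hedgeProb
  rw [← Finset.sum_div, div_self (sum_hedgeWeight_pos hw η ℓ n).ne']

/-- For losses in `{0, 1}` the ratio of consecutive total weights is exactly the Bernoulli moment
generating function at the learner's expected loss. -/
theorem sum_hedgeWeight_succ_le [Nonempty ι] {w : ι → ℝ} (hw : ∀ i, 0 < w i) (η : ℝ)
    {ℓ : ι → ℕ → ℝ} (hℓ : ∀ i n, ℓ i n = 0 ∨ ℓ i n = 1) (n : ℕ) :
    ∑ i, hedgeWeight w η ℓ (n + 1) i ≤ (∑ i, hedgeWeight w η ℓ n i) *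
      Real.exp (-η * (∑ i, hedgeProb w η ℓ n i * ℓ i n) + η ^ 2 / 8) := by
  have hW := sum_hedgeWeight_pos hw η ℓ n
  set W := ∑ i, hedgeWeight w η ℓ n i with hWdef
  set q := ∑ i, hedgeProb w η ℓ n i * ℓ i n with hq
  have h01 : ∀ i, 0 ≤ ℓ i n ∧ ℓ i n ≤ 1 := fun i => by
    rcases hℓ i n with h | h <;> rw [h] <;> norm_num
  have hq0 : 0 ≤ q := Finset.sum_nonneg fun i _ =>
    mul_nonneg (hedgeProb_nonneg hw η ℓ n i) (h01 i).1
  have hq1 : q ≤ 1 := by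
    rw [← sum_hedgeProb hw η ℓ n]
    exact Finset.sum_le_sum fun i _ =>
      mul_le_of_le_one_right (hedgeProb_nonneg hw η ℓ n i) (h01 i).2
  refine le_trans (le_of_eq ?_) (mul_le_mul_of_nonneg_left (bernoulli_mgf_le hq0 hq1 η) hW.le)
  have hWq : W * q = ∑ i, hedgeWeight w η ℓ n i * ℓ i n := by
    rw [hq, Finset.mul_sum]
    refine Finset.sum_congr rfl fun i _ => ?_
    unfold hedgeProb
    rw [← hWdef]
    field_simp
  have step : ∀ i, hedgeWeight w η ℓ (n + 1) i =
      hedgeWeight w η ℓ n i - hedgeWeight w η ℓ n i * ℓ i n +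
        hedgeWeight w η ℓ n i * ℓ i n * Real.exp (-η) := by
    intro i
    unfold hedgeWeight
    rw [Finset.sum_range_succ, mul_add, Real.exp_add]
    rcases hℓ i n with h | h <;> rw [h] <;> simp
    ring
  rw [Finset.sum_congr rfl fun i _ => step i, Finset.sum_add_distrib, Finset.sum_sub_distrib,
    ← Finset.sum_mul, ← hWq]
  ring

theorem sum_hedgeWeight_le [Nonempty ι] {w : ι → ℝ} (hw : ∀ i, 0 < w i) (η : ℝ)
    {ℓ : ι → ℕ → ℝ} (hℓ : ∀ i n, ℓ i n = 0 ∨ ℓ i n = 1) (n : ℕ) :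
    ∑ i, hedgeWeight w η ℓ n i ≤ (∑ i, w i) *
      Real.exp (-η * (∑ s ∈ Finset.range n, ∑ i, hedgeProb w η ℓ s i * ℓ i s) +
        n * (η ^ 2 / 8)) := by
  induction n with
  | zero => simp [hedgeWeight]
  | succ n ih =>
    refine (sum_hedgeWeight_succ_le hw η hℓ n).trans ?_
    refine (mul_le_mul_of_nonneg_right ih (Real.exp_pos _).le).trans (le_of_eq ?_)
    rw [mul_assoc, ← Real.exp_add, Finset.sum_range_succ]
    push_cast
    ring_nf

/-- The regret bound of the exponential weights algorithm. -/
theorem hedge_le [Nonempty ι] {w : ι → ℝ} (hw : ∀ i, 0 < w i) {η : ℝ} (hη : 0 < η)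
    {ℓ : ι → ℕ → ℝ} (hℓ : ∀ i n, ℓ i n = 0 ∨ ℓ i n = 1) (n : ℕ) (i : ι) :
    ∑ s ∈ Finset.range n, ∑ i, hedgeProb w η ℓ s i * ℓ i s ≤
      ∑ s ∈ Finset.range n, ℓ i s + Real.log ((∑ j, w j) / w i) / η + η * n / 8 := by
  set Q := ∑ s ∈ Finset.range n, ∑ i, hedgeProb w η ℓ s i * ℓ i s with hQ
  set L := ∑ s ∈ Finset.range n, ℓ i s with hL
  have hW : 0 < ∑ j, w j := Finset.sum_pos (fun i _ => hw i) Finset.univ_nonempty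
  have h1 : w i * Real.exp (-η * L) ≤ (∑ j, w j) * Real.exp (-η * Q + n * (η ^ 2 / 8)) :=
    (Finset.single_le_sum (f := fun i => hedgeWeight w η ℓ n i)
      (fun i _ => (hedgeWeight_pos hw η ℓ n i).le) (Finset.mem_univ i)).trans
      (sum_hedgeWeight_le hw η hℓ n)
  have h2 := Real.log_le_log (mul_pos (hw i) (Real.exp_pos _)) h1
  rw [Real.log_mul (hw i).ne' (Real.exp_pos _).ne', Real.log_mul hW.ne' (Real.exp_pos _).ne',
    Real.log_exp, Real.log_exp] at h2
  rw [Real.log_div hW.ne' (hw i).ne']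
  refine le_of_mul_le_mul_left ?_ hη
  have e : η * (L + (Real.log (∑ j, w j) - Real.log (w i)) / η + η * n / 8) =
      η * L + (Real.log (∑ j, w j) - Real.log (w i)) + n * (η ^ 2 / 8) := by
    field_simp
  rw [e]
  linarith

end Hedge

/-! ### Learners from experts -/

section Learner

theorem exists_conceptMistakes_eq {T : ℕ} {C : Set (X → Y)} (hC : C.Nonempty) (x : Fin T → X)
    (y : Fin T → Y) : ∃ c ∈ C, conceptMistakes c x y = bestMistakes C x y := by
  have : Nonempty C := hC.to_subtype
  obtain ⟨c, hc⟩ := Nat.sInf_mem (Set.range_nonempty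
    fun c : C => conceptMistakes (c : X → Y) x y)
  exact ⟨c, c.2, hc⟩

variable [MeasurableSpace Y]

theorem exists_learner_of_nonanticipating [Nonempty Y] {T : ℕ}
    (P : (Fin T → X) → (Fin T → Y) → Fin T → ProbabilityMeasure Y)
    (hP : ∀ x y y' t, (∀ s, s < t → y s = y' s) → P x y t = P x y' t) :
    ∃ A : Learner X Y T, ∀ x y t, A x t (Fin.take t t.isLt.le y) = P x y t := by
  -- Unrevealed labels are filled in arbitrarily; by `hP` they do not matter.
  refine ⟨fun x t h => P x (fun s => if hs : s < t then h ⟨s, hs⟩ else Classical.arbitrary Y) t,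
    fun x y t => hP _ _ _ _ fun s hs => ?_⟩
  rw [dif_pos hs]
  rfl

/-- The distribution of the prediction of an expert drawn with the given probabilities. -/
theorem exists_mixture {ι : Type*} [Fintype ι] {p : ι → ℝ} (hp : ∀ i, 0 ≤ p i)
    (hp1 : ∑ i, p i = 1) (e : ι → Y) :
    ∃ μ : ProbabilityMeasure Y,
      (μ : Measure Y) = ∑ i, ENNReal.ofReal (p i) • Measure.dirac (e i) := by
  refine ⟨⟨∑ i, ENNReal.ofReal (p i) • Measure.dirac (e i), ⟨?_⟩⟩, rfl⟩
  rw [Measure.finsetSum_apply]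
  simp only [Measure.smul_apply, measure_univ, smul_eq_mul, mul_one]
  rw [← ENNReal.ofReal_sum_of_nonneg fun i _ => hp i, hp1, ENNReal.ofReal_one]

open Classical in
theorem integral_indicator_mixture [MeasurableSingletonClass Y] {ι : Type*} [Fintype ι]
    {p : ι → ℝ} (hp : ∀ i, 0 ≤ p i) (e : ι → Y) (y : Y) :
    ∫ z : Y, Set.indicator {z : Y | z ≠ y} (fun _ => (1 : ℝ)) z
      ∂(∑ i, ENNReal.ofReal (p i) • Measure.dirac (e i)) =
      ∑ i, p i * if e i ≠ y then 1 else 0 := by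
  rw [integral_finsetSum_measure]
  · refine Finset.sum_congr rfl fun i _ => ?_
    rw [integral_smul_measure, integral_dirac, ENNReal.toReal_ofReal (hp i), smul_eq_mul]
    simp [Set.indicator_apply]
  · exact fun i _ => (integrable_dirac (by simp)).smul_measure ENNReal.ofReal_ne_top

open Classical in
/-- A learner that follows the experts `e` with exponential weights. -/
theorem exists_hedge_learner [MeasurableSingletonClass Y] [Nonempty Y] {T : ℕ} {ι : Type*}
    [Fintype ι] [Nonempty ι] {w : ι → ℝ} (hw : ∀ i, 0 < w i) {η : ℝ} (hη : 0 < η)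
    (e : (Fin T → X) → ι → (Fin T → Y) → Fin T → Y)
    (he : ∀ x i y y' t, (∀ s, s < t → y s = y' s) → e x i y t = e x i y' t) :
    ∃ A : Learner X Y T, ∀ x y i, expectedMistakes A x y ≤
      ((∑ t, if e x i y t ≠ y t then 1 else 0 : ℕ) : ℝ) + Real.log ((∑ j, w j) / w i) / η +
        η * T / 8 := by
  set ℓ : (Fin T → X) → (Fin T → Y) → ι → ℕ → ℝ := fun x y i n =>
    if h : n < T then (if e x i y ⟨n, h⟩ ≠ y ⟨n, h⟩ then 1 else 0) else 0 with hℓdef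
  have hℓ : ∀ x y i n, ℓ x y i n = 0 ∨ ℓ x y i n = 1 := by
    intro x y i n
    simp only [hℓdef]
    split_ifs <;> simp
  have hℓt : ∀ x y i (t : Fin T), ℓ x y i t = if e x i y t ≠ y t then 1 else 0 := by
    intro x y i t
    simp only [hℓdef]
    rw [dif_pos t.isLt]
  choose P hP using fun (x : Fin T → X) (y : Fin T → Y) (t : Fin T) =>
    exists_mixture (hedgeProb_nonneg hw η (ℓ x y) t) (sum_hedgeProb hw η (ℓ x y) t)
      (fun i => e x i y t)
  obtain ⟨A, hA⟩ := exists_learner_of_nonanticipating P (by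
    intro x y y' t h
    refine Subtype.ext ?_
    change (P x y t : Measure Y) = (P x y' t : Measure Y)
    rw [hP, hP]
    have h1 : hedgeProb w η (ℓ x y) t = hedgeProb w η (ℓ x y') t := by
      refine hedgeProb_congr w η fun i s hs => ?_
      have hsT : s < T := lt_trans hs t.isLt
      have h2 := hℓt x y i ⟨s, hsT⟩
      have h3 := hℓt x y' i ⟨s, hsT⟩
      rw [he x i y y' ⟨s, hsT⟩ fun r hr => h r (lt_trans hr hs), h ⟨s, hsT⟩ hs, ← h3] at h2
      exact h2
    refine Finset.sum_congr rfl fun i _ => ?_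
    rw [h1, he x i y y' t h])
  refine ⟨A, fun x y i => ?_⟩
  have h := hedge_le hw hη (hℓ x y) T i
  rw [Finset.sum_range, Finset.sum_range] at h
  have e1 : expectedMistakes A x y =
      ∑ t : Fin T, ∑ i, hedgeProb w η (ℓ x y) t i * ℓ x y i t := by
    refine Finset.sum_congr rfl fun t _ => ?_
    rw [hA, hP, integral_indicator_mixture (hedgeProb_nonneg hw η (ℓ x y) t)]
    refine Finset.sum_congr rfl fun i _ => ?_
    rw [hℓt]
  have e2 : ((∑ t, if e x i y t ≠ y t then 1 else 0 : ℕ) : ℝ) = ∑ t : Fin T, ℓ x y i t := by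
    push_cast
    exact Finset.sum_congr rfl fun t _ => (hℓt x y i t).symm
  rw [e1, e2]
  exact h

theorem optimalRegret_le_of_learner {T : ℕ} {C : Set (X → Y)} (hC : C.Nonempty)
    (A : Learner X Y T) {r : ℝ}
    (h : ∀ x y, ∀ c ∈ C, expectedMistakes A x y ≤ conceptMistakes c x y + r) :
    optimalRegret T C ≤ (r : EReal) := by
  refine (iInf_le _ A).trans (iSup₂_le fun x y => EReal.coe_le_coe_iff.2 ?_)
  obtain ⟨c, hc, hcy⟩ := exists_conceptMistakes_eq hC x y
  have := h x y c hc
  rw [hcy] at this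
  linarith

/-- The regret bound for exponential weights over the experts, where the expert with rounds `I`
has weight `p ^ |I|`. -/
theorem optimalRegret_le_of_shatterCount [MeasurableSingletonClass Y] [Nonempty Y] {T : ℕ}
    (hT : 0 < T) {C : Set (X → Y)} (hC : C.Nonempty) {p R M : ℝ} (hp : 0 < p) (hp1 : p ≤ 1)
    (hR : 0 < R) (hB : T * (T * Real.log (1 + p) - M * Real.log p) ≤ 2 * R ^ 2)
    (hM : ∀ l : List X, l.length = T → Real.log (shatterCount l C) ≤ M * Real.log 2) :
    optimalRegret T C ≤ ((M + R : ℝ) : EReal) := by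
  classical
  have hTr : (0 : ℝ) < T := by exact_mod_cast hT
  -- This learning rate makes the term `η * T / 8` equal to `R / 2`; `hB` says that the logarithmic
  -- term is then at most `R / 2` too.
  have hη : 0 < 4 * R / T := by positivity
  obtain ⟨A, hA⟩ := exists_hedge_learner (w := fun I : Finset (Fin T) => p ^ I.card)
    (fun I => pow_pos hp _) hη (fun x I y t => expert C x I y t)
    (fun x I y y' t h => expert_congr (fun _ _ => Iff.rfl) h)
  refine optimalRegret_le_of_learner hC A fun x y c hc => ?_
  obtain ⟨I, hI1, hI2⟩ := exists_expert x y hc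
  refine (hA x y I).trans ?_
  have hsum : ∑ J : Finset (Fin T), p ^ J.card = (1 + p) ^ T := by
    have := Finset.sum_pow_mul_eq_add_pow p 1 (Finset.univ : Finset (Fin T))
    simpa [add_comm] using this
  have hIM : (I.card : ℝ) ≤ M := by
    have h1 : ((2 : ℝ) ^ I.card) ≤ shatterCount (List.ofFn x) C := by exact_mod_cast hI1
    have h2 := Real.log_le_log (by positivity) h1
    rw [Real.log_pow] at h2
    exact le_of_mul_le_mul_right (h2.trans (hM _ (by simp))) (Real.log_pos one_lt_two)
  have hlog : Real.log ((∑ J : Finset (Fin T), p ^ J.card) / p ^ I.card) ≤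
      T * Real.log (1 + p) - M * Real.log p := by
    rw [hsum, Real.log_div (by positivity) (by positivity), Real.log_pow, Real.log_pow]
    have := Real.log_nonpos hp.le hp1
    nlinarith
  have h2 : ((∑ t, if expert C x I y t ≠ y t then 1 else 0 : ℕ) : ℝ) ≤
      conceptMistakes c x y + I.card := by exact_mod_cast hI2
  have h3 : Real.log ((∑ J : Finset (Fin T), p ^ J.card) / p ^ I.card) / (4 * R / T) ≤
      R / 2 := by
    rw [div_le_iff₀ hη]
    have h4 := mul_le_mul_of_nonneg_left hlog hTr.le
    have h5 : R / 2 * (4 * R / T) = 2 * R ^ 2 / T := by ring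
    rw [h5, le_div_iff₀ hTr]
    linarith
  have h4 : 4 * R / T * T / 8 = R / 2 := by field_simp; ring
  rw [h4]
  linarith

theorem optimalRegret_le_self [MeasurableSingletonClass Y] [Nonempty Y] {T : ℕ} {C : Set (X → Y)} (hC : C.Nonempty) :
    optimalRegret T C ≤ ((T : ℝ) : EReal) := by
  refine optimalRegret_le_of_learner hC
    (fun _ _ _ => ⟨Measure.dirac (Classical.arbitrary Y), inferInstance⟩) fun x y c _ => ?_
  have h0 : (0 : ℝ) ≤ conceptMistakes c x y := Nat.cast_nonneg _
  refine le_trans ?_ (le_add_of_nonneg_left h0)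
  unfold expectedMistakes
  refine (Finset.sum_le_card_nsmul Finset.univ _ 1 fun t _ => ?_).trans (by simp)
  refine (integral_dirac _ _).trans_le ?_
  exact Set.indicator_le_self' (fun _ _ => zero_le_one) _

/-- Two concepts differing at `z` would shatter `[z]`, so the class is a single concept, which the
learner follows. -/
theorem optimalRegret_le_zero [MeasurableSingletonClass Y] {T : ℕ} {C : Set (X → Y)}
    (hC : C.Nonempty) (h : ∀ l : List X, Shatters l C → l.length ≤ 0) :
    optimalRegret T C ≤ ((0 : ℝ) : EReal) := by
  classical
  obtain ⟨c₀, hc₀⟩ := hC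
  refine optimalRegret_le_of_learner ⟨c₀, hc₀⟩
    (fun x t _ => ⟨Measure.dirac (c₀ (x t)), inferInstance⟩) fun x y c hc => ?_
  have hcc : c = c₀ := by
    funext z
    by_contra hne
    have := h [z] ⟨c z, c₀ z, hne, ⟨c, hc, rfl⟩, ⟨c₀, hc₀, rfl⟩⟩
    simp at this
  rw [hcc, add_zero, conceptMistakes_eq_sum]
  push_cast
  unfold expectedMistakes
  refine Finset.sum_le_sum fun t _ => le_of_eq ?_
  refine (integral_dirac _ _).trans ?_
  simp [Set.indicator_apply]

end Learner

/-! ### Numerical estimates -/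

theorem log_351_ge : (1.2556 : ℝ) ≤ Real.log 3.51 := by
  have h := Real.sum_range_le_log_div (x := 151 / 551) (by norm_num) (by norm_num) 4
  rw [show ((1 : ℝ) + 151 / 551) / (1 - 151 / 551) = 3.51 / 2 by norm_num,
    Real.log_div (by norm_num) (by norm_num)] at h
  norm_num [Finset.sum_range_succ] at h
  have h2 := Real.log_two_gt_d9
  norm_num at h2 ⊢
  linarith

theorem log_54_ge : (1.686 : ℝ) ≤ Real.log 5.4 := by
  have h := Real.sum_range_le_log_div (x := 7 / 47) (by norm_num) (by norm_num) 2
  rw [show ((1 : ℝ) + 7 / 47) / (1 - 7 / 47) = 5.4 / 2 ^ 2 by norm_num,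
    Real.log_div (by norm_num) (by norm_num), Real.log_pow] at h
  norm_num [Finset.sum_range_succ] at h
  have h2 := Real.log_two_gt_d9
  norm_num at h2 ⊢
  linarith

theorem log_63_ge : (1.8 : ℝ) ≤ Real.log 6.3 := by
  have h := Real.sum_range_le_log_div (x := 23 / 103) (by norm_num) (by norm_num) 1
  rw [show ((1 : ℝ) + 23 / 103) / (1 - 23 / 103) = 6.3 / 2 ^ 2 by norm_num,
    Real.log_div (by norm_num) (by norm_num), Real.log_pow] at h
  norm_num [Finset.sum_range_succ] at h
  have h2 := Real.log_two_gt_d9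
  norm_num at h2 ⊢
  linarith

theorem chord_le_log {a b s : ℝ} (ha : 0 < a) (has : a ≤ s) (hsb : s ≤ b) :
    (b - s) * Real.log a + (s - a) * Real.log b ≤ (b - a) * Real.log s := by
  rcases has.eq_or_lt with rfl | h
  · simp
  have hab : 0 < b - a := by linarith
  have hc := strictConcaveOn_log_Ioi.concaveOn.2 (x := a) (y := b) ha
    (show b ∈ Set.Ioi (0 : ℝ) from lt_of_lt_of_le (ha.trans h) hsb)
    (div_nonneg (sub_nonneg.2 hsb) hab.le) (div_nonneg (sub_nonneg.2 has) hab.le)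
    (by field_simp; ring)
  simp only [smul_eq_mul] at hc
  rw [show (b - s) / (b - a) * a + (s - a) / (b - a) * b = s by field_simp; ring] at hc
  have := mul_le_mul_of_nonneg_left hc hab.le
  refine le_trans (le_of_eq ?_) this
  field_simp

/-- By concavity of the logarithm it is enough to compare the endpoints: equality at 1, and `1 + 2 *
1.2556 = 3.5112` at 3.51. -/
theorem le_one_add_two_mul_log {s : ℝ} (h1 : 1 ≤ s) (h2 : s ≤ 3.51) :
    s ≤ 1 + 2 * Real.log s := by
  have h := chord_le_log one_pos h1 h2
  rw [Real.log_one] at h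
  have h3 := mul_le_mul_of_nonneg_left log_351_ge (sub_nonneg.2 h1)
  norm_num at h h3
  linarith

theorem inv_log_two_le : 1 / Real.log 2 ≤ 1.442696 := by
  rw [div_le_iff₀ (Real.log_pos one_lt_two)]
  have := Real.log_two_gt_d9
  norm_num at this ⊢
  linarith

theorem medium_estimate {s : ℝ} (h1 : 3.51 ≤ s) (h2 : s ≤ 5.4) :
    (1 + 2 * Real.log s) / Real.log 2 + 0.58871 * s ^ 2 ≤ s * (1 + 2 * Real.log s) := by
  have h := chord_le_log (by norm_num) h1 h2
  have h3 := mul_le_mul_of_nonneg_left log_351_ge (sub_nonneg.2 h2)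
  have h4 := mul_le_mul_of_nonneg_left log_54_ge (sub_nonneg.2 h1)
  -- The chord of the concave right side over `[3.51, 5.4]`, rounded down; it reduces the claim to a
  -- quadratic inequality in `s`.
  have hA : 3.5112 + 0.4554 * (s - 3.51) ≤ 1 + 2 * Real.log s := by
    norm_num at h h3 h4 h1 h2 ⊢
    linarith
  set A := 1 + 2 * Real.log s
  have hA0 : 0 ≤ A := by norm_num at hA h1; linarith
  have h5 : A / Real.log 2 ≤ 1.442696 * A := by
    rw [div_eq_mul_one_div, mul_comm]
    exact mul_le_mul_of_nonneg_right inv_log_two_le hA0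
  have h6 : (3.5112 + 0.4554 * (s - 3.51)) * (s - 1.442696) ≤ A * (s - 1.442696) :=
    mul_le_mul_of_nonneg_right hA (by norm_num at h1 ⊢; linarith)
  have h7 := mul_nonneg (sub_nonneg.2 h1) (sub_nonneg.2 h2)
  norm_num at h5 h6 h7 h1 h2 ⊢
  nlinarith

theorem log_ge_of_large {s : ℝ} (h : 5.4 ≤ s) : 4.372 ≤ 1 + 2 * Real.log s := by
  have := log_54_ge.trans (Real.log_le_log (by norm_num) h)
  norm_num at this ⊢
  linarith

theorem large_estimate {s : ℝ} (h : 5.4 ≤ s) :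
    (1 + 2 * Real.log s) / Real.log 2 + s * (0.8494 * (1 + 2 * Real.log s - 0.9)) ≤
      s * (1 + 2 * Real.log s) := by
  have hA := log_ge_of_large h
  have hlog : s ≤ 9.6 → 1 + 2 * Real.log s ≤ 6.55 := by
    intro hs
    have h1 : Real.log s ≤ Real.log (2 ^ 4) :=
      Real.log_le_log (by norm_num at h; linarith) (by norm_num at hs ⊢; linarith)
    rw [Real.log_pow] at h1
    have h2 := Real.log_two_lt_d9
    norm_num at h1 h2 ⊢
    linarith
  set A := 1 + 2 * Real.log s
  have hA0 : 0 ≤ A := by norm_num at hA; linarith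
  have h5 : A / Real.log 2 ≤ 1.442696 * A := by
    rw [div_eq_mul_one_div, mul_comm]
    exact mul_le_mul_of_nonneg_right inv_log_two_le hA0
  have h6 : 1.442696 * A ≤ s * (0.1506 * A + 0.76446) := by
    have h7 : 0 ≤ 0.1506 * A + 0.76446 := by positivity
    -- From 9.6 on the term `0.1506 * s * A` suffices alone; below it `A ≤ 6.55`, and then `s ≥ 5.4`
    -- is enough.
    rcases le_total s 9.6 with hs | hs
    · have h8 := hlog hs
      have h9 := mul_le_mul_of_nonneg_right h h7
      norm_num at h8 h9 hA ⊢
      linarith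
    · have h9 := mul_le_mul_of_nonneg_right hs h7
      norm_num at h9 hA ⊢
      linarith
  norm_num at h5 h6 ⊢
  linarith

theorem div_log_two_ge {A : ℝ} (hA : 4.372 ≤ A) : 6.3 ≤ A / Real.log 2 := by
  rw [le_div_iff₀ (Real.log_pos one_lt_two)]
  have := Real.log_two_lt_d9
  norm_num at this hA ⊢
  linarith

/-- Since `log (A / log 2) ≥ 1.8`, completing the square in `A * (A - 1.8)` gives the shift 0.9; the
factor 0.8494 is just above `1 / √(2 log 2)`. -/
theorem large_variance_estimate {A : ℝ} (hA : 4.372 ≤ A) :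
    A / Real.log 2 * (A - Real.log (A / Real.log 2)) ≤ 2 * (0.8494 * (A - 0.9)) ^ 2 := by
  have hm := div_log_two_ge hA
  have hlog := log_63_ge.trans (Real.log_le_log (by norm_num) hm)
  have hA0 : 0 ≤ A := by norm_num at hA; linarith
  have h5 : A / Real.log 2 ≤ 1.442696 * A := by
    rw [div_eq_mul_one_div, mul_comm]
    exact mul_le_mul_of_nonneg_right inv_log_two_le hA0
  have h6 : A / Real.log 2 * (A - Real.log (A / Real.log 2)) ≤ 1.442696 * A * (A - 1.8) := by
    refine (mul_le_mul_of_nonneg_left (sub_le_sub_left hlog A) ?_).trans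
      (mul_le_mul_of_nonneg_right h5 ?_)
    · exact div_nonneg hA0 (Real.log_pos one_lt_two).le
    · norm_num at hA ⊢
      linarith
  refine h6.trans ?_
  norm_num at hA ⊢
  nlinarith

theorem div_log_two_le_sq {s : ℝ} (h : 5.4 ≤ s) : (1 + 2 * Real.log s) / Real.log 2 ≤ s ^ 2 := by
  have hs : 0 < s := by norm_num at h; linarith
  have h1 := Real.log_le_sub_one_of_pos hs
  have h0 : 0 ≤ Real.log s := Real.log_nonneg (by norm_num at h; linarith)
  have h5 : (1 + 2 * Real.log s) / Real.log 2 ≤ 1.442696 * (1 + 2 * Real.log s) := by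
    rw [div_eq_mul_one_div, mul_comm]
    exact mul_le_mul_of_nonneg_right inv_log_two_le (by linarith)
  refine h5.trans ?_
  norm_num at h ⊢
  nlinarith

/-! ### The upper bound -/

theorem log_shatterCount_le {C : Set (X → Y)} (hC : C.Nonempty) {D T : ℕ} (hD : 1 ≤ D)
    (hDT : D ≤ T) (hmax : ∀ l : List X, Shatters l C → l.length ≤ D) {l : List X}
    (hl : l.length = T) :
    Real.log (shatterCount l C) ≤ D * (1 + Real.log (T / D)) := by
  have hD0 : (0 : ℝ) < D := by exact_mod_cast hD
  have hT0 : (0 : ℝ) < T := by exact_mod_cast hD.trans hDT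
  have hp : (0 : ℝ) < D / T := div_pos hD0 hT0
  have hp1 : (D : ℝ) / T ≤ 1 := (div_le_one hT0).2 (by exact_mod_cast hDT)
  have h := shatterCount_mul_pow_le l C hmax hp hp1
  have hN : (0 : ℝ) < shatterCount l C := by exact_mod_cast shatterCount_pos hC l
  have h1 := Real.log_le_log (by positivity) h
  rw [hl, Real.log_mul hN.ne' (by positivity), Real.log_pow, Real.log_pow] at h1
  have h2 := mul_le_mul_of_nonneg_left (Real.log_le_sub_one_of_pos
    -- The choice `p = D / T` gives `(1 + p) ^ T ≤ e ^ D`, hence the bound `(eT/D)^D`.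
    (show (0 : ℝ) < 1 + D / T by positivity)) hT0.le
  have h3 : (T : ℝ) * (1 + D / T - 1) = D := by field_simp; ring
  have h4 : Real.log (T / D) = -Real.log (D / T) := by rw [← Real.log_inv, inv_div]
  rw [h4]
  linarith

theorem optimalRegret_le [Nonempty Y] [MeasurableSpace Y] [MeasurableSingletonClass Y]
    {C : Set (X → Y)} (hC : C.Nonempty) {D T : ℕ} (hD : 1 ≤ D) (hDT : D ≤ T)
    (hmax : ∀ l : List X, Shatters l C → l.length ≤ D) {s : ℝ} (hs : 1 ≤ s)
    (hT : (T : ℝ) = D * s ^ 2) :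
    optimalRegret T C ≤ ((D * s * (1 + 2 * Real.log s) : ℝ) : EReal) := by
  have hD0 : (0 : ℝ) < D := by exact_mod_cast hD
  have hT0 : 0 < T := hD.trans hDT
  have hs0 : 0 < s := by linarith
  have hlog2 : 0 < Real.log 2 := Real.log_pos one_lt_two
  rcases le_total s 3.51 with h1 | h1
  · refine (optimalRegret_le_self hC).trans (EReal.coe_le_coe_iff.2 ?_)
    rw [hT]
    have := mul_le_mul_of_nonneg_left (le_one_add_two_mul_log hs h1)
      (mul_nonneg hD0.le hs0.le)
    linarith
  set A := 1 + 2 * Real.log s with hA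
  have hM : ∀ l : List X, l.length = T →
      Real.log (shatterCount l C) ≤ D * (A / Real.log 2) * Real.log 2 := by
    intro l hl
    have h := log_shatterCount_le hC hD hDT hmax hl
    rw [hT, mul_div_cancel_left₀ _ hD0.ne', Real.log_pow] at h
    rw [mul_assoc, div_mul_cancel₀ _ hlog2.ne']
    exact_mod_cast h
  rcases le_total s 5.4 with h2 | h2
  -- With `p = 1` all subsets weigh the same and `hB` reads `T² log 2 ≤ 2R²`; 0.58871 is just above
  -- `√(log 2 / 2)`.
  · refine (optimalRegret_le_of_shatterCount hT0 hC (p := 1) (R := D * (0.58871 * s ^ 2))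
      one_pos le_rfl (by positivity) ?_ hM).trans (EReal.coe_le_coe_iff.2 ?_)
    · rw [Real.log_one, mul_zero, sub_zero, hT, one_add_one_eq_two]
      have h3 := Real.log_two_lt_d9
      have h4 : (0 : ℝ) ≤ (D * s ^ 2) ^ 2 := by positivity
      have h5 := mul_le_mul_of_nonneg_left h3.le h4
      norm_num at h5 ⊢
      nlinarith
    · have h3 := mul_le_mul_of_nonneg_left (medium_estimate h1 h2) hD0.le
      linarith
  · have hA4 := log_ge_of_large h2
    rw [← hA] at hA4
    have hA9 : 0 < A - 0.9 := by norm_num at hA4 ⊢; linarith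
    have hm := div_log_two_ge hA4
    have hm0 : 0 < A / Real.log 2 := by norm_num at hm; linarith
    set m := A / Real.log 2 with hmdef
    have hp : 0 < m / s ^ 2 := by positivity
    -- Here `M = D * m` and `p = M / T`, so `T * log (1 + p) ≤ M` and `hB` follows from `m * (A -
    -- log m) ≤ 2 * (0.8494 * (A - 0.9)) ^ 2`.
    refine (optimalRegret_le_of_shatterCount hT0 hC (p := m / s ^ 2)
      (R := D * (s * (0.8494 * (A - 0.9)))) hp
      ((div_le_one (by positivity)).2 (div_log_two_le_sq h2)) (by positivity) ?_ hM).trans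
      (EReal.coe_le_coe_iff.2 ?_)
    · have h3 := Real.log_le_sub_one_of_pos (show 0 < 1 + m / s ^ 2 by positivity)
      have h4 : (T : ℝ) * Real.log (1 + m / s ^ 2) ≤ D * m := by
        refine (mul_le_mul_of_nonneg_left h3 (Nat.cast_nonneg T)).trans (le_of_eq ?_)
        rw [hT]
        field_simp
        ring
      have h5 : Real.log (m / s ^ 2) = Real.log m - (A - 1) := by
        rw [Real.log_div hm0.ne' (by positivity), Real.log_pow, hA]
        push_cast
        ring
      have h6 := large_variance_estimate hA4
      rw [← hmdef] at h6
      have h7 : (T : ℝ) * (T * Real.log (1 + m / s ^ 2) - D * m * Real.log (m / s ^ 2)) ≤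
          T * (D * m - D * m * Real.log (m / s ^ 2)) :=
        mul_le_mul_of_nonneg_left (by linarith) (Nat.cast_nonneg T)
      refine h7.trans ?_
      rw [h5, hT]
      have h8 := mul_le_mul_of_nonneg_left h6 (show (0 : ℝ) ≤ (D * s) ^ 2 by positivity)
      linarith
    · have h3 := mul_le_mul_of_nonneg_left (large_estimate h2) hD0.le
      linarith

end TransductiveOnline

end

theorem mainTheorem3 {X Y : Type*} [Nonempty X] [MeasurableSpace Y] [MeasurableSingletonClass Y]
    (C : Set (X → Y)) (hC : C.Nonempty) (T : ℕ)
    (hT : TransductiveOnline.levelDim C ≤ (T : ℕ∞)) :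
    ((Real.sqrt ((T : ℝ) * ((TransductiveOnline.levelDim C).toNat : ℝ) / 8) : ℝ) : EReal) ≤
        TransductiveOnline.optimalRegret T C ∧
      TransductiveOnline.optimalRegret T C ≤
        ((Real.sqrt ((T : ℝ) * ((TransductiveOnline.levelDim C).toNat : ℝ)) *
          Real.log (Real.exp 1 * (T : ℝ) / ((TransductiveOnline.levelDim C).toNat : ℝ)) : ℝ) :
            EReal) := by
  obtain ⟨D, hD, hDT, ⟨l, hl, hlC⟩, hmax⟩ := TransductiveOnline.exists_levelDim_eq C hC hT
  have : Nonempty Y := ⟨hC.some (Classical.arbitrary X)⟩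
  rw [hD, ENat.toNat_natCast]
  refine ⟨TransductiveOnline.sqrt_le_optimalRegret hC hDT hl hlC, ?_⟩
  rcases Nat.eq_zero_or_pos D with rfl | hD1
  · simpa using TransductiveOnline.optimalRegret_le_zero hC hmax
  have hD0 : (0 : ℝ) < D := by exact_mod_cast hD1
  have hDT' : (D : ℝ) ≤ T := by exact_mod_cast hDT
  have hT0 : (0 : ℝ) < T := hD0.trans_le hDT'
  set s := Real.sqrt (T / D) with hs
  have hs1 : 1 ≤ s := Real.one_le_sqrt.2 ((one_le_div hD0).2 hDT')
  have hss : s ^ 2 = T / D := Real.sq_sqrt (by positivity)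
  have hTs : (T : ℝ) = D * s ^ 2 := by rw [hss]; field_simp
  refine (TransductiveOnline.optimalRegret_le hC hD1 hDT hmax hs1 hTs).trans (le_of_eq ?_)
  have e1 : Real.sqrt ((T : ℝ) * D) = D * s := by
    rw [hTs, show (D : ℝ) * s ^ 2 * D = (D * s) ^ 2 by ring]
    exact Real.sqrt_sq (by positivity)
  have e2 : Real.log (Real.exp 1 * (T : ℝ) / D) = 1 + 2 * Real.log s := by
    rw [mul_div_assoc, ← hss, Real.log_mul (Real.exp_pos 1).ne' (by positivity), Real.log_exp,
      Real.log_pow]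
    push_cast
    ring
  rw [e1, e2]
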